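/- Conventions. All systems are finite-dimensional and shared by Alice and Bob. An LOCC protocol is a finite sequence of local generalized measurements (with Kraus operators $K_i$, $\sum_i K_i^\dagger K_i=1$, possibly changing the local dimension), whose outcomes are communicated and may determine the later steps; a probabilistic LOCC protocol may in addition discard (declare failed) some branches, so it is trace-nonincreasing. Let $|\phi_2^+\rangle=(|00\rangle+|11\rangle)/\sqrt2$ be the singlet. A probabilistic LOCC protocol $\Lambda$ converts $\rho$ into a singlet with fidelity at least $f$ and probability $p>0$ if $\operatorname{Tr}\Lambda[\rho]=p$ and $\langle\phi_2^+|\Lambda[\rho]|\phi_2^+\rangle/p\ge f$. A state $\rho$ can be converted into $\sigma$ with catalysis if for every $\delta>0$ there are a bipartite catalyst density matrix $\tau$ and an LOCC protocol $\Lambda$ such that $\|\Lambda[\rho\otimes\tau]-\sigma\otimes\tau\|_1<\delta$ and $\operatorname{Tr}_S\Lambda[\rho\otimes\tau]=\tau$, where $\operatorname{Tr}_S$ traces out the non-catalyst system. The entanglement entropy of a bipartite pure state $\psi$ is $E(\psi)=S(\psi^A)$, where $\psi^A$ is Alice's reduced state and $S(\rho)=-\operatorname{Tr}\rho\log_2\rho$.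 **Theorem.** For every $f>\tfrac12$ and every $\varepsilon>0$ there are numbers $p_i\in(0,1)$, $i=1,2,\dots$, such that the two-qubit pure states $|\psi_i\rangle=\sqrt{1-p_i}\,|00\rangle+\sqrt{p_i}\,|11\rangle$ have the following properties. 1. For every $n$, the optimal (supremal) probability of converting $\bigotimes_{i=1}^n\psi_i$ into a singlet with fidelity at least $f$ by probabilistic LOCC is smaller than $\varepsilon$ (it is understood to be $0$ if no such conversion exists). 2. The entanglement entropy $E\left(\bigotimes_{i=1}^n\psi_i\right)$ tends to infinity as $n\to\infty$. 3. An unbounded number of singlets can be extracted with catalysis: for every $m$, for all sufficiently large $n$, the state $\bigotimes_{i=1}^n\psi_i$ can be converted into $|\phi_2^+\rangle\langle\phi_2^+|^{\otimes m}$ with catalysis. -/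

import Mathlib

open scoped Kronecker ComplexOrder

/- Conventions. A finite-dimensional Hilbert space with an orthonormal basis labelled by a finite
type `A` is `A → ℂ`.  A state of a bipartite system of Alice (basis `A`) and Bob (basis `B`) is a
matrix indexed by `A × B`, a pure state vector is a function on `A × B`. -/

namespace Catalysis

/-- Density matrices: positive semidefinite of trace one. -/
def IsDensity {X : Type} [Fintype X] (ρ : Matrix X X ℂ) : Prop :=
  ρ.PosSemidef ∧ ρ.trace = 1

/-- The projector `|ψ⟩⟨ψ|`. -/
def pureState {X : Type} (ψ : X → ℂ) : Matrix X X ℂ :=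
  Matrix.vecMulVec ψ (star ψ)

/-- The number `⟨φ|σ|φ⟩`, for `σ` positive semidefinite. -/
noncomputable def overlap {X : Type} [Fintype X] (φ : X → ℂ) (σ : Matrix X X ℂ) : ℝ :=
  (star φ ⬝ᵥ (σ.mulVec φ)).re

/-- The trace norm `‖M‖₁ = Tr √(M† M)`, the sum of the singular values of `M`. -/
noncomputable def traceNorm {X : Type} [Fintype X] [DecidableEq X] (M : Matrix X X ℂ) : ℝ :=
  ∑ i, Real.sqrt ((Matrix.isHermitian_conjTranspose_mul_self M).eigenvalues i)

/-- The tensor product of a state of `A, B` with a state of `C, D`, regarded as a bipartite state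
in which Alice holds `A × C` and Bob holds `B × D`. -/
def bipartiteTensor {A B C D : Type} (ρ : Matrix (A × B) (A × B) ℂ)
    (τ : Matrix (C × D) (C × D) ℂ) : Matrix ((A × C) × (B × D)) ((A × C) × (B × D)) ℂ :=
  (ρ ⊗ₖ τ).submatrix (Equiv.prodProdProdComm A C B D) (Equiv.prodProdProdComm A C B D)

/-- The partial trace over the systems `A, B`, leaving a state of `C, D`. -/
def traceOutSystem {A B C D : Type} [Fintype A] [Fintype B]
    (μ : Matrix ((A × C) × (B × D)) ((A × C) × (B × D)) ℂ) : Matrix (C × D) (C × D) ℂ :=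
  Matrix.of fun x y => ∑ a, ∑ b, μ ((a, x.1), (b, x.2)) ((a, y.1), (b, y.2))

/-- The partial trace over Bob's system, leaving the reduced state of Alice. -/
def traceOutBob {A B : Type} [Fintype B] (ρ : Matrix (A × B) (A × B) ℂ) : Matrix A A ℂ :=
  Matrix.of fun a a' => ∑ b, ρ (a, b) (a', b)

/-- The von Neumann entropy `S(ρ) = -Tr (ρ log₂ ρ)` of a Hermitian matrix. -/
noncomputable def vonNeumannEntropy {X : Type} [Fintype X] [DecidableEq X]
    (ρ : Matrix X X ℂ) (hρ : ρ.IsHermitian) : ℝ :=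
  ∑ i, -(hρ.eigenvalues i * Real.logb 2 (hρ.eigenvalues i))

theorem traceOutBob_pureState_isHermitian {A B : Type} [Fintype B] (ψ : A × B → ℂ) :
    (traceOutBob (pureState ψ)).IsHermitian := by
  ext a a'
  simp [traceOutBob, pureState, Matrix.vecMulVec_apply, mul_comm]

/-- The entanglement entropy of a bipartite pure state. -/
noncomputable def entanglementEntropy {A B : Type} [Fintype A] [DecidableEq A] [Fintype B]
    (ψ : A × B → ℂ) : ℝ :=
  vonNeumannEntropy (traceOutBob (pureState ψ)) (traceOutBob_pureState_isHermitian ψ)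

/-- Maps implemented by a finite protocol of local operations and classical communication.
A protocol either stops (`done`), or declares failure if this is allowed (`abort`), or one of the
parties performs a generalized measurement with Kraus operators `K i`, `∑ i, K i† K i = 1`, which
may change the dimension of the local system (so local ancillas and discarding are included),
announces the outcome `i`, and both go on with a protocol that may depend on `i`.
The final state is summed over all outcomes; failed branches do not contribute. -/
inductive ProtocolMap (canAbort : Prop) {A' B' : Type} : ∀ {A B : Type},
    (Matrix (A × B) (A × B) ℂ → Matrix (A' × B') (A' × B') ℂ) → Prop
  | done : ProtocolMap canAbort (fun ρ : Matrix (A' × B') (A' × B') ℂ => ρ)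
  | abort {A B : Type} (h : canAbort) :
      ProtocolMap canAbort (fun _ : Matrix (A × B) (A × B) ℂ => 0)
  | alice {A B A₁ : Type} [Fintype A] [DecidableEq A] [Fintype A₁] [Fintype B] [DecidableEq B]
      {r : ℕ} (K : Fin r → Matrix A₁ A ℂ) (hK : ∑ i, (K i).conjTranspose * K i = 1)
      (Λ : Fin r → Matrix (A₁ × B) (A₁ × B) ℂ → Matrix (A' × B') (A' × B') ℂ)
      (hΛ : ∀ i, ProtocolMap canAbort (Λ i)) :
      ProtocolMap canAbort (fun ρ : Matrix (A × B) (A × B) ℂ =>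
        ∑ i, Λ i ((K i ⊗ₖ (1 : Matrix B B ℂ)) * ρ *
          (K i ⊗ₖ (1 : Matrix B B ℂ)).conjTranspose))
  | bob {A B B₁ : Type} [Fintype B] [DecidableEq B] [Fintype B₁] [Fintype A] [DecidableEq A]
      {r : ℕ} (K : Fin r → Matrix B₁ B ℂ) (hK : ∑ i, (K i).conjTranspose * K i = 1)
      (Λ : Fin r → Matrix (A × B₁) (A × B₁) ℂ → Matrix (A' × B') (A' × B') ℂ)
      (hΛ : ∀ i, ProtocolMap canAbort (Λ i)) :
      ProtocolMap canAbort (fun ρ : Matrix (A × B) (A × B) ℂ =>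
        ∑ i, Λ i (((1 : Matrix A A ℂ) ⊗ₖ K i) * ρ *
          ((1 : Matrix A A ℂ) ⊗ₖ K i).conjTranspose))

/-- (Deterministic, trace-preserving) LOCC protocols. -/
def IsLOCC {A B A' B' : Type}
    (Λ : Matrix (A × B) (A × B) ℂ → Matrix (A' × B') (A' × B') ℂ) : Prop :=
  ProtocolMap False Λ

/-- Probabilistic (trace-nonincreasing) LOCC protocols. -/
def IsProbabilisticLOCC {A B A' B' : Type}
    (Λ : Matrix (A × B) (A × B) ℂ → Matrix (A' × B') (A' × B') ℂ) : Prop :=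
  ProtocolMap True Λ

/-- The singlet, i.e. the maximally entangled two-qubit state `(|00⟩ + |11⟩) / √2`. -/
noncomputable def singlet : Fin 2 × Fin 2 → ℂ :=
  fun x => if x.1 = x.2 then ((1 / Real.sqrt 2 : ℝ) : ℂ) else 0

/-- The two-qubit pure state `√(1 - p) |00⟩ + √p |11⟩`. -/
noncomputable def twoQubitState (p : ℝ) : Fin 2 × Fin 2 → ℂ :=
  fun x => if x = (0, 0) then ((Real.sqrt (1 - p) : ℝ) : ℂ)
    else if x = (1, 1) then ((Real.sqrt p : ℝ) : ℂ) else 0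

/-- The product `ψ 0 ⊗ ⋯ ⊗ ψ (n - 1)` of two-qubit pure states; Alice holds the `n` first qubits,
Bob the `n` second ones. -/
def productState (ψ : ℕ → Fin 2 × Fin 2 → ℂ) (n : ℕ) :
    (Fin n → Fin 2) × (Fin n → Fin 2) → ℂ :=
  fun x => ∏ i : Fin n, ψ i (x.1 i, x.2 i)

/-- The success probabilities of the probabilistic LOCC protocols that turn `ρ` into a singlet with
fidelity at least `f`. -/
def singletProbabilities {A B : Type} (ρ : Matrix (A × B) (A × B) ℂ) (f : ℝ) : Set ℝ :=
  {p | ∃ Λ : Matrix (A × B) (A × B) ℂ → Matrix (Fin 2 × Fin 2) (Fin 2 × Fin 2) ℂ,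
    IsProbabilisticLOCC Λ ∧ (Λ ρ).trace = (p : ℂ) ∧ 0 < p ∧ f ≤ overlap singlet (Λ ρ) / p}

/-- Approximate catalytic LOCC conversion of `ρ` into `σ`: for every error `δ > 0` there are a
finite-dimensional catalyst state `τ` and an LOCC protocol that maps `ρ ⊗ τ` to a state `δ`-close
to `σ ⊗ τ` and returns the catalyst in exactly the state `τ`. -/
def CatalyticallyConvertible {A B A' B' : Type}
    [Fintype A'] [DecidableEq A'] [Fintype B'] [DecidableEq B']
    (ρ : Matrix (A × B) (A × B) ℂ) (σ : Matrix (A' × B') (A' × B') ℂ) : Prop :=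
  ∀ δ : ℝ, 0 < δ →
    ∃ (C D : Type) (_ : Fintype C) (_ : DecidableEq C) (_ : Fintype D) (_ : DecidableEq D)
      (τ : Matrix (C × D) (C × D) ℂ)
      (Λ : Matrix ((A × C) × (B × D)) ((A × C) × (B × D)) ℂ →
        Matrix ((A' × C) × (B' × D)) ((A' × C) × (B' × D)) ℂ),
      IsDensity τ ∧ IsLOCC Λ ∧
      traceNorm (Λ (bipartiteTensor ρ τ) - bipartiteTensor σ τ) < δ ∧
      traceOutSystem (Λ (bipartiteTensor ρ τ)) = τ

end Catalysis

namespace Catalysis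

set_option linter.unusedSectionVars false

/-! The `p i` are chosen with `∑ p i` as small as desired but `∑ p i * -log (p i) = ∞`; a multiple
of `1 / (N (log N + 1)²)` does this. The small sum gives property 1 and the divergent sum gives
properties 2 and 3.

Small sum: the product state is a multiple of `|0…0⟩|0…0⟩` plus a vector `w` with `‖w‖² ≤ ∑ p i`,
uniformly in `n`. LOCC sends a product vector to a mixture of product vectors, whose overlap with
the singlet is at most half of their trace. A fidelity `f > 1/2` must therefore come from `w`, and a
perturbation argument (`exists_trace_le`) bounds the success probability by `K ‖w‖²`, with `K`
depending on `f` only.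

Large entropy: the entropy is the sum of the binary entropies of the `p i`, each at least `-p i *
logb 2 (p i)` (`entanglementEntropy_ge`).

Catalysis: for fixed `n`, many copies of the state are concentrated into `m` singlets per copy with
vanishing error (`exists_concentration`, `sum_mod_card_le`, `exists_small_error`). The crude rate
condition `2 m log 2 < ∑ p i * -log (p i)` suffices because the sum diverges. A many-copy conversion
becomes a catalytic single-copy one (`exists_catalyst`): the catalyst is a partially converted chain
with one position missing, mixed uniformly over that position. The input fills the gap, the chain
moves on by one step, and a converted system comes out while the catalyst returns exactly to its
state.

All states on this side have the form `∑ R x y |xx⟩⟨yy|`, and both parties apply the same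
measurement of the label. The bipartite problem thus reduces to operations on the coefficient matrix
`R` (`exists_isLOCC_maxCorrelated`). -/

/-! ### Trace norm of Hermitian matrices. -/

open Matrix Polynomial in
theorem sum_eigenvalues_of_charpoly {X Y : Type} [Fintype X] [DecidableEq X] [Fintype Y]
    {A : Matrix X X ℂ} (hA : A.IsHermitian) (d : Y → ℝ)
    (h : A.charpoly = ∏ y, (Polynomial.X - C (d y : ℂ))) (f : ℝ → ℝ) :
    ∑ i, f (hA.eigenvalues i) = ∑ y, f (d y) := by
  have h1 := hA.roots_charpoly_eq_eigenvalues
  have h2 : A.charpoly.roots = Multiset.map (fun y => (d y : ℂ)) Finset.univ.val := by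
    rw [h]
    have := Polynomial.roots_multiset_prod_X_sub_C
      (Multiset.map (fun y => (d y : ℂ)) Finset.univ.val)
    rw [Multiset.map_map] at this
    exact this
  rw [h1] at h2
  have h3 := congrArg (fun s => (s.map (fun z : ℂ => f z.re)).sum) h2
  simp only [Multiset.map_map, Function.comp_def] at h3
  exact h3

open Matrix Polynomial in
theorem traceNorm_of_isHermitian {X : Type} [Fintype X] [DecidableEq X] {M : Matrix X X ℂ}
    (hM : M.IsHermitian) : traceNorm M = ∑ i, |hM.eigenvalues i| := by
  have key : (Mᴴ * M).charpoly = ∏ i, (Polynomial.X - C (((hM.eigenvalues i) ^ 2 : ℝ) : ℂ)) := by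
    rw [hM.eq]
    have hs := hM.spectral_theorem
    have h2 : M * M = Unitary.conjStarAlgAut ℂ _ hM.eigenvectorUnitary
        (diagonal (fun i => (((hM.eigenvalues i) ^ 2 : ℝ) : ℂ))) := by
      conv_lhs => rw [hs, ← map_mul, diagonal_mul_diagonal]
      congr 2
      ext i
      simp [sq]
    rw [h2, Unitary.conjStarAlgAut_apply, charpoly_mul_comm, ← mul_assoc]
    simp [charpoly_diagonal]
  rw [traceNorm, sum_eigenvalues_of_charpoly _ _ key]
  exact Finset.sum_congr rfl fun i _ => Real.sqrt_sq_eq_abs _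

-- In an eigenbasis of `P - Q` each eigenvalue is a difference of two nonnegative diagonal entries,
-- so its modulus is at most their sum; these sums add up to the traces.
open Matrix in
theorem traceNorm_sub_le {X : Type} [Fintype X] [DecidableEq X] {P Q : Matrix X X ℂ}
    (hP : P.PosSemidef) (hQ : Q.PosSemidef) :
    traceNorm (P - Q) ≤ P.trace.re + Q.trace.re := by
  have hM : (P - Q).IsHermitian := hP.1.sub hQ.1
  rw [traceNorm_of_isHermitian hM]
  have tr : ∀ R : Matrix X X ℂ, R.trace.re =
      ∑ i, (star (hM.eigenvectorBasis i).ofLp ⬝ᵥ (R *ᵥ (hM.eigenvectorBasis i).ofLp)).re := by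
    intro R
    set U := (hM.eigenvectorUnitary : Matrix X X ℂ) with hU
    have h1 : R.trace = (star U * R * U).trace := by
      rw [mul_assoc, trace_mul_comm, mul_assoc]
      simp [hU]
    rw [h1, trace, Complex.re_sum]
    refine Finset.sum_congr rfl fun i _ => ?_
    congr 1
    rw [diag_apply, mul_assoc, mul_apply_eq_vecMul]
    simp only [vecMul, dotProduct, mul_apply, mulVec, hU, IsHermitian.eigenvectorUnitary_apply,
      star_apply, Pi.star_apply]
  rw [tr P, tr Q, ← Finset.sum_add_distrib]
  refine Finset.sum_le_sum fun i _ => ?_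
  have hp := (hP.dotProduct_mulVec_nonneg (hM.eigenvectorBasis i).ofLp)
  have hq := (hQ.dotProduct_mulVec_nonneg (hM.eigenvectorBasis i).ofLp)
  have he := hM.eigenvalues_eq i
  rw [sub_mulVec, dotProduct_sub] at he
  rw [he]
  have hp' := (Complex.le_def.1 hp).1
  have hq' := (Complex.le_def.1 hq).1
  simp only [Complex.zero_re] at hp' hq'
  rw [abs_le]
  constructor <;> simp <;> linarith

/-! ### Maximally correlated states. -/

/-- The maximally correlated matrix on `X × X` with coefficients `R`. -/
def maxCorrelated {X : Type} [DecidableEq X] (R : Matrix X X ℂ) : Matrix (X × X) (X × X) ℂ :=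
  Matrix.of fun p q => if p.1 = p.2 ∧ q.1 = q.2 then R p.1 q.1 else 0

section maxCorrelated

variable {X Y : Type} [DecidableEq X] [DecidableEq Y]

theorem maxCorrelated_sub (R S : Matrix X X ℂ) :
    maxCorrelated (R - S) = maxCorrelated R - maxCorrelated S := by
  ext p q
  simp only [maxCorrelated, Matrix.of_apply, Matrix.sub_apply]
  split_ifs <;> simp

theorem trace_maxCorrelated [Fintype X] (R : Matrix X X ℂ) :
    (maxCorrelated R).trace = R.trace := by
  simp [Matrix.trace, maxCorrelated, Fintype.sum_prod_type]

open Matrix in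
theorem posSemidef_maxCorrelated [Fintype X] {R : Matrix X X ℂ} (hR : R.PosSemidef) :
    (maxCorrelated R).PosSemidef := by
  have : maxCorrelated R = (of fun (p : X × X) (x : X) => if p.1 = x ∧ p.2 = x then (1 : ℂ) else 0)
      * R * (of fun (p : X × X) (x : X) => if p.1 = x ∧ p.2 = x then (1 : ℂ) else 0)ᴴ := by
    ext ⟨p, p'⟩ ⟨q, q'⟩
    simp only [maxCorrelated, mul_apply, of_apply, conjTranspose_apply]
    by_cases h1 : p = p' <;> by_cases h2 : q = q'
    · subst h1 h2
      simp
    · subst h1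
      have : ∀ x, ¬ (q = x ∧ q' = x) := by rintro x ⟨rfl, rfl⟩; exact h2 rfl
      simp [h2, this]
    · have : ∀ x, ¬ (p = x ∧ p' = x) := by rintro x ⟨rfl, rfl⟩; exact h1 rfl
      simp [h1, this]
    · have : ∀ x, ¬ (p = x ∧ p' = x) := by rintro x ⟨rfl, rfl⟩; exact h1 rfl
      simp [h1, this]
  rw [this]
  exact hR.mul_mul_conjTranspose_same _

theorem bipartiteTensor_maxCorrelated (R : Matrix X X ℂ) (S : Matrix Y Y ℂ) :
    bipartiteTensor (maxCorrelated R) (maxCorrelated S) = maxCorrelated (R ⊗ₖ S) := by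
  ext ⟨⟨a, c⟩, ⟨b, d⟩⟩ ⟨⟨a', c'⟩, ⟨b', d'⟩⟩
  simp only [bipartiteTensor, maxCorrelated, Matrix.submatrix_apply, Matrix.kroneckerMap_apply,
    Equiv.prodProdProdComm_apply, Matrix.of_apply, Prod.mk.injEq]
  by_cases h1 : a = b <;> by_cases h2 : c = d <;> by_cases h3 : a' = b' <;>
    by_cases h4 : c' = d' <;> simp [h1, h2, h3, h4]

/-- The partial trace over the first factor of a product. -/
def traceLeft [Fintype X] (R : Matrix (X × Y) (X × Y) ℂ) : Matrix Y Y ℂ :=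
  ∑ x, R.submatrix (fun y => (x, y)) (fun y => (x, y))

theorem traceOutSystem_maxCorrelated [Fintype X] (R : Matrix (X × Y) (X × Y) ℂ) :
    traceOutSystem (maxCorrelated R) = maxCorrelated (traceLeft R) := by
  ext ⟨c, d⟩ ⟨c', d'⟩
  simp only [traceOutSystem, maxCorrelated, traceLeft, Matrix.of_apply, Prod.mk.injEq,
    Matrix.sum_apply, Matrix.submatrix_apply]
  by_cases h2 : c = d <;> by_cases h4 : c' = d' <;> simp [h2, h4]

end maxCorrelated

/-! ### Measurements of labels and their implementation by LOCC. -/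

/-- The Kraus operator for outcome `i` of the measurement described by a labelling `F`. -/
def labelKraus {Y I Z : Type} [DecidableEq I] [DecidableEq Z] (F : Y → I × Z) (i : I) :
    Matrix Z Y ℂ :=
  Matrix.of fun z y => if F y = (i, z) then 1 else 0

/-- The channel that measures the first component of `F` and outputs the second. -/
def labelChannel {Y I Z : Type} [Fintype Y] [Fintype I] [DecidableEq I] [DecidableEq Z]
    (F : Y → I × Z) (R : Matrix Y Y ℂ) : Matrix Z Z ℂ :=
  ∑ i, labelKraus F i * R * (labelKraus F i).conjTranspose

section labelChannel

variable {X Y I J Z W : Type} [Fintype X] [Fintype Y] [Fintype Z] [Fintype I] [Fintype J]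
  [DecidableEq I] [DecidableEq J] [DecidableEq Z] [DecidableEq W] [DecidableEq Y]

theorem labelChannel_apply (F : Y → I × Z) (R : Matrix Y Y ℂ) (z w : Z) :
    labelChannel F R z w =
      ∑ x, ∑ y, if (F x).2 = z ∧ (F y).2 = w ∧ (F x).1 = (F y).1 then R x y else 0 := by
  simp only [labelChannel, Matrix.sum_apply, Matrix.mul_apply, labelKraus, Matrix.of_apply,
    Matrix.conjTranspose_apply, Finset.sum_mul]
  rw [Finset.sum_comm]
  simp_rw [Finset.sum_comm (s := (Finset.univ : Finset I))]
  rw [Finset.sum_comm]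
  refine Finset.sum_congr rfl fun x _ => Finset.sum_congr rfl fun y _ => ?_
  rw [Finset.sum_eq_single (F x).1]
  · by_cases h1 : (F x).2 = z
    · by_cases h2 : F y = ((F x).1, w)
      · simp [h2, ← h1]
      · have : ¬ ((F y).2 = w ∧ (F x).1 = (F y).1) := by
          rintro ⟨h3, h4⟩; exact h2 (Prod.ext h4.symm h3)
        simp [h1, h2, this]
    · have : F x ≠ ((F x).1, z) := fun h => h1 (congrArg Prod.snd h)
      simp [h1, this]
  · intro i _ hi
    have : F x ≠ (i, z) := fun h => hi (congrArg Prod.fst h).symm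
    simp [this]
  · simp

/-- The `(x, y)` entry counts the pairs `(i, z)` equal to both `F x` and `F y`, so injectivity of
`F` yields completeness. -/
theorem sum_labelKraus {F : Y → I × Z} (hF : Function.Injective F) :
    ∑ i, (labelKraus F i).conjTranspose * labelKraus F i = 1 := by
  ext x y
  simp only [Matrix.sum_apply, Matrix.mul_apply, labelKraus, Matrix.of_apply,
    Matrix.conjTranspose_apply]
  rw [← Finset.sum_product', Finset.univ_product_univ, Finset.sum_eq_single (F x)]
  · by_cases h : x = y
    · subst h; simp
    · have : F y ≠ F x := fun h' => h (hF h').symm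
      simp [h, this]
  · intro p _ hp
    simp [Ne.symm hp]
  · simp

theorem labelChannel_sub (F : Y → I × Z) (R S : Matrix Y Y ℂ) :
    labelChannel F (R - S) = labelChannel F R - labelChannel F S := by
  simp [labelChannel, Matrix.mul_sub, Matrix.sub_mul, Finset.sum_sub_distrib]

theorem labelChannel_smul (F : Y → I × Z) (c : ℂ) (R : Matrix Y Y ℂ) :
    labelChannel F (c • R) = c • labelChannel F R := by
  simp [labelChannel, Finset.smul_sum]

theorem posSemidef_labelChannel (F : Y → I × Z) {R : Matrix Y Y ℂ} (hR : R.PosSemidef) :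
    (labelChannel F R).PosSemidef :=
  Matrix.posSemidef_sum _ fun _ _ => hR.mul_mul_conjTranspose_same _

theorem trace_labelChannel {F : Y → I × Z} (hF : Function.Injective F) (R : Matrix Y Y ℂ) :
    (labelChannel F R).trace = R.trace := by
  simp only [labelChannel, Matrix.trace_sum]
  simp_rw [Matrix.mul_assoc, Matrix.trace_mul_comm (labelKraus F _), Matrix.mul_assoc]
  rw [← Matrix.trace_sum, ← Matrix.mul_sum, sum_labelKraus hF, mul_one]

/-- Running the labelling `G` after the labelling `F`. -/
def labelComp (G : Z → J × W) (F : Y → I × Z) : Y → (I × J) × W :=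
  fun y => (((F y).1, (G (F y).2).1), (G (F y).2).2)

theorem labelComp_injective {G : Z → J × W} {F : Y → I × Z} (hG : Function.Injective G)
    (hF : Function.Injective F) : Function.Injective (labelComp G F) := by
  intro x y h
  simp only [labelComp, Prod.mk.injEq] at h
  exact hF (Prod.ext h.1.1 (hG (Prod.ext h.1.2 h.2)))

/-- Closure under composition lets the whole catalytic protocol be a single labelling, to which
`exists_isLOCC_maxCorrelated` applies once. -/
theorem labelChannel_labelComp (G : Z → J × W) (F : Y → I × Z) (R : Matrix Y Y ℂ) :
    labelChannel (labelComp G F) R = labelChannel G (labelChannel F R) := by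
  have h : ∀ p : I × J,
      labelKraus (labelComp G F) p = labelKraus G p.2 * labelKraus F p.1 := by
    intro p
    ext w y
    simp only [labelKraus, labelComp, Matrix.of_apply, Matrix.mul_apply]
    rw [Finset.sum_eq_single (F y).2]
    · rcases p with ⟨i, j⟩
      by_cases h1 : (F y).1 = i
      · have : F y = (i, (F y).2) := Prod.ext h1 rfl
        simp only [← this]
        by_cases h2 : G (F y).2 = (j, w)
        · simp [h1, h2]
        · have : ¬ ((G (F y).2).1 = j ∧ (G (F y).2).2 = w) := fun h => h2 (Prod.ext h.1 h.2)
          simp [h1, h2, this]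
      · have : F y ≠ (i, (F y).2) := fun h => h1 (congrArg Prod.fst h)
        simp [h1, this]
    · intro z _ hz
      have : F y ≠ (p.1, z) := fun h => hz (congrArg Prod.snd h).symm
      simp [this]
    · simp
  simp only [labelChannel, Matrix.mul_sum, Matrix.sum_mul, Fintype.sum_prod_type, h,
    Matrix.conjTranspose_mul, Matrix.mul_assoc]
  rw [Finset.sum_comm]

/-- A labelling without outcome given by a bijection. -/
def equivLabel (e : Y ≃ Z) : Y → Unit × Z := fun y => ((), e y)

theorem equivLabel_injective (e : Y ≃ Z) : Function.Injective (equivLabel e) := by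
  intro x y h
  simpa [equivLabel] using h

theorem labelChannel_equivLabel (e : Y ≃ Z) (R : Matrix Y Y ℂ) :
    labelChannel (equivLabel e) R = R.submatrix e.symm e.symm := by
  ext z w
  rw [labelChannel_apply, Finset.sum_eq_single (e.symm z), Finset.sum_eq_single (e.symm w)]
  · simp [equivLabel]
  · intro y _ hy
    have : e y ≠ w := fun h => hy (by simp [← h])
    simp [equivLabel, this]
  · simp
  · intro y _ hy
    have : e y ≠ z := fun h => hy (by simp [← h])
    simp [equivLabel, this]
  · simp

/-- Both parties perform the measurement described by the labelling `F`. -/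
theorem exists_isLOCC_maxCorrelated {F : Y → I × Z} (hF : Function.Injective F) :
    ∃ Λ : Matrix (Y × Y) (Y × Y) ℂ → Matrix (Z × Z) (Z × Z) ℂ, IsLOCC Λ ∧
      ∀ R, Λ (maxCorrelated R) = maxCorrelated (labelChannel F R) := by
  have hK : ∑ i : Fin (Fintype.card I), (labelKraus F ((Fintype.equivFin I).symm i)).conjTranspose *
      labelKraus F ((Fintype.equivFin I).symm i) = 1 := by
    rw [(Fintype.equivFin I).symm.sum_comp
      (fun i => (labelKraus F i).conjTranspose * labelKraus F i), sum_labelKraus hF]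
  -- Neither party needs the other's message: on a maximally correlated state both labels agree, and
  -- so do the outcomes.
  refine ⟨_, ProtocolMap.alice _ hK _ fun _ => ProtocolMap.bob _ hK _ fun _ => ProtocolMap.done, ?_⟩
  intro R
  have e : ∀ G : I → I → Matrix (Z × Z) (Z × Z) ℂ,
      ∑ i, ∑ j, G ((Fintype.equivFin I).symm i) ((Fintype.equivFin I).symm j) =
        ∑ i, ∑ j, G i j := by
    intro G
    rw [(Fintype.equivFin I).symm.sum_comp
      (fun i => ∑ j, G i ((Fintype.equivFin I).symm j))]
    exact Finset.sum_congr rfl fun i _ => (Fintype.equivFin I).symm.sum_comp (G i)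
  refine (e fun i j => ((1 : Matrix Z Z ℂ) ⊗ₖ labelKraus F j) *
    ((labelKraus F i ⊗ₖ (1 : Matrix Y Y ℂ)) *
      maxCorrelated R * (labelKraus F i ⊗ₖ (1 : Matrix Y Y ℂ)).conjTranspose) *
        ((1 : Matrix Z Z ℂ) ⊗ₖ labelKraus F j).conjTranspose).trans ?_
  have h : ∀ i j, ((1 : Matrix Z Z ℂ) ⊗ₖ labelKraus F j) * ((labelKraus F i ⊗ₖ (1 : Matrix Y Y ℂ)) *
      maxCorrelated R * (labelKraus F i ⊗ₖ (1 : Matrix Y Y ℂ)).conjTranspose) *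
        ((1 : Matrix Z Z ℂ) ⊗ₖ labelKraus F j).conjTranspose =
      (labelKraus F i ⊗ₖ labelKraus F j) * maxCorrelated R *
        (labelKraus F i ⊗ₖ labelKraus F j).conjTranspose := by
    intro i j
    have : labelKraus F i ⊗ₖ labelKraus F j =
        ((1 : Matrix Z Z ℂ) ⊗ₖ labelKraus F j) * (labelKraus F i ⊗ₖ (1 : Matrix Y Y ℂ)) := by
      rw [← Matrix.mul_kronecker_mul]; simp
    rw [this, Matrix.conjTranspose_mul]
    simp only [Matrix.mul_assoc]
  simp_rw [h]
  ext ⟨u, u'⟩ ⟨w, w'⟩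
  have h2 : ∀ i j, ((labelKraus F i ⊗ₖ labelKraus F j) * maxCorrelated R *
        (labelKraus F i ⊗ₖ labelKraus F j).conjTranspose) (u, u') (w, w') =
      ∑ y, ∑ x, if F x = (i, u) ∧ F x = (j, u') ∧ F y = (i, w) ∧ F y = (j, w')
        then R x y else 0 := by
    intro i j
    simp only [Matrix.mul_apply, Fintype.sum_prod_type, Matrix.kroneckerMap_apply, labelKraus,
      maxCorrelated, Matrix.of_apply, Matrix.conjTranspose_apply]
    simp only [ite_and, mul_ite, mul_zero, Finset.sum_ite_eq, Finset.mem_univ, if_true, mul_one,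
      ite_mul, one_mul, zero_mul, Finset.sum_mul]
    refine Finset.sum_congr rfl fun y _ => ?_
    rw [Finset.sum_eq_single y]
    · simp only [if_true]
      refine Finset.sum_congr rfl fun x _ => ?_
      by_cases h1 : F x = (i, u) <;> by_cases h2 : F x = (j, u') <;>
        by_cases h3 : F y = (i, w) <;> by_cases h4 : F y = (j, w') <;> simp [h1, h2, h3, h4]
    · intro y' _ hy'
      simp [Ne.symm hy']
    · simp
  simp only [Matrix.sum_apply, h2]
  simp only [maxCorrelated, Matrix.of_apply]
  by_cases hu : u = u' ∧ w = w'
  · obtain ⟨rfl, rfl⟩ := hu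
    simp only [labelChannel, Matrix.sum_apply, and_self, if_true]
    refine Finset.sum_congr rfl fun i _ => ?_
    rw [Finset.sum_eq_single i]
    · simp only [Matrix.mul_apply, labelKraus, Matrix.of_apply, Matrix.conjTranspose_apply,
        Finset.sum_mul]
      refine Finset.sum_congr rfl fun y _ => Finset.sum_congr rfl fun x _ => ?_
      by_cases h1 : F x = (i, u) <;> by_cases h3 : F y = (i, w) <;> simp [h1, h3]
    -- Different outcomes `i ≠ j` would require one label `x` to have two values of `F x`.
    · intro j _ hj
      refine Finset.sum_eq_zero fun y _ => Finset.sum_eq_zero fun x _ => ?_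
      rw [if_neg]
      rintro ⟨h1, h2, -⟩
      exact hj (congrArg Prod.fst (h2.symm.trans h1))
    · simp
  · rw [if_neg hu]
    refine Finset.sum_eq_zero fun i _ => Finset.sum_eq_zero fun j _ =>
      Finset.sum_eq_zero fun y _ => Finset.sum_eq_zero fun x _ => ?_
    rw [if_neg]
    rintro ⟨h1, h2, h3, h4⟩
    exact hu ⟨congrArg Prod.snd (h1.symm.trans h2), congrArg Prod.snd (h3.symm.trans h4)⟩

end labelChannel

/-! ### Chains of systems: replacing positions one at a time. -/

section chain

variable {X : Type} [Fintype X] [DecidableEq X] {M : ℕ}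

/-- The partial trace over position `k`. -/
def traceAt (k : Fin (M + 1)) (W : Matrix (Fin (M + 1) → X) (Fin (M + 1) → X) ℂ) :
    Matrix (Fin M → X) (Fin M → X) ℂ :=
  ∑ z : X, W.submatrix (fun u => k.insertNth (α := fun _ => X) z u)
    (fun u => k.insertNth (α := fun _ => X) z u)

/-- The tensor product of `V` with `r`, placed at position `k`. -/
def insertAt (k : Fin (M + 1)) (r : Matrix X X ℂ) (V : Matrix (Fin M → X) (Fin M → X) ℂ) :
    Matrix (Fin (M + 1) → X) (Fin (M + 1) → X) ℂ :=
  (r ⊗ₖ V).submatrix (fun x => (x k, k.removeNth x)) (fun x => (x k, k.removeNth x))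

/-- The tensor product of a family of matrices. -/
def tensorFamily {n : ℕ} (m : Fin n → Matrix X X ℂ) : Matrix (Fin n → X) (Fin n → X) ℂ :=
  Matrix.of fun x y => ∏ j, m j (x j) (y j)

/-- Successively replace the first `k` systems by fresh copies of `r`. -/
noncomputable def refresh (r : Matrix X X ℂ)
    (W : Matrix (Fin (M + 1) → X) (Fin (M + 1) → X) ℂ) :
    ℕ → Matrix (Fin (M + 1) → X) (Fin (M + 1) → X) ℂ
  | 0 => W
  | k + 1 => if h : k < M + 1 then insertAt ⟨k, h⟩ r (traceAt ⟨k, h⟩ (refresh r W k))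
      else refresh r W k

theorem refresh_succ (r : Matrix X X ℂ) (W : Matrix (Fin (M + 1) → X) (Fin (M + 1) → X) ℂ)
    (k : Fin (M + 1)) :
    refresh r W (k + 1) = insertAt k r (traceAt k (refresh r W k)) := by
  rw [refresh, dif_pos k.2]

theorem traceAt_add (k : Fin (M + 1)) (V W : Matrix (Fin (M + 1) → X) (Fin (M + 1) → X) ℂ) :
    traceAt k (V + W) = traceAt k V + traceAt k W := by
  simp [traceAt, Matrix.submatrix_add, Finset.sum_add_distrib]

theorem traceAt_smul (k : Fin (M + 1)) (c : ℂ)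
    (W : Matrix (Fin (M + 1) → X) (Fin (M + 1) → X) ℂ) :
    traceAt k (c • W) = c • traceAt k W := by
  simp [traceAt, Matrix.submatrix_smul, Finset.smul_sum]

theorem insertAt_add (k : Fin (M + 1)) (r : Matrix X X ℂ)
    (V W : Matrix (Fin M → X) (Fin M → X) ℂ) :
    insertAt k r (V + W) = insertAt k r V + insertAt k r W := by
  simp [insertAt, Matrix.kronecker_add, Matrix.submatrix_add]

theorem insertAt_smul (k : Fin (M + 1)) (r : Matrix X X ℂ) (c : ℂ)
    (V : Matrix (Fin M → X) (Fin M → X) ℂ) :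
    insertAt k r (c • V) = c • insertAt k r V := by
  simp [insertAt, Matrix.kronecker_smul, Matrix.submatrix_smul]

theorem trace_traceAt (k : Fin (M + 1)) (W : Matrix (Fin (M + 1) → X) (Fin (M + 1) → X) ℂ) :
    (traceAt k W).trace = W.trace := by
  rw [traceAt, Matrix.trace_sum]
  simp only [Matrix.trace, Matrix.diag_apply, Matrix.submatrix_apply]
  rw [← Finset.sum_product', Finset.univ_product_univ]
  exact (Fin.insertNthEquiv (fun _ => X) k).sum_comp (fun x => W x x)

theorem trace_insertAt (k : Fin (M + 1)) (r : Matrix X X ℂ)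
    (V : Matrix (Fin M → X) (Fin M → X) ℂ) :
    (insertAt k r V).trace = r.trace * V.trace := by
  rw [← Matrix.trace_kronecker]
  exact (Fin.insertNthEquiv (fun _ => X) k).symm.sum_comp (fun p => (r ⊗ₖ V) p p)

theorem posSemidef_traceAt (k : Fin (M + 1))
    {W : Matrix (Fin (M + 1) → X) (Fin (M + 1) → X) ℂ} (hW : W.PosSemidef) :
    (traceAt k W).PosSemidef :=
  Matrix.posSemidef_sum _ fun _ _ => hW.submatrix _

theorem posSemidef_insertAt (k : Fin (M + 1)) {r : Matrix X X ℂ} (hr : r.PosSemidef)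
    {V : Matrix (Fin M → X) (Fin M → X) ℂ} (hV : V.PosSemidef) :
    (insertAt k r V).PosSemidef :=
  (hr.kronecker hV).submatrix _

theorem refresh_add (r : Matrix X X ℂ) (V W : Matrix (Fin (M + 1) → X) (Fin (M + 1) → X) ℂ)
    (k : ℕ) : refresh r (V + W) k = refresh r V k + refresh r W k := by
  induction k with
  | zero => rfl
  | succ k ih =>
    simp only [refresh, ih, traceAt_add, insertAt_add]
    split_ifs <;> rfl

theorem refresh_smul (r : Matrix X X ℂ) (c : ℂ)
    (W : Matrix (Fin (M + 1) → X) (Fin (M + 1) → X) ℂ)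
    (k : ℕ) : refresh r (c • W) k = c • refresh r W k := by
  induction k with
  | zero => rfl
  | succ k ih =>
    simp only [refresh, ih, traceAt_smul, insertAt_smul]
    split_ifs <;> rfl

theorem trace_refresh {r : Matrix X X ℂ} (hr : r.trace = 1)
    (W : Matrix (Fin (M + 1) → X) (Fin (M + 1) → X) ℂ) (k : ℕ) :
    (refresh r W k).trace = W.trace := by
  induction k with
  | zero => rfl
  | succ k ih =>
    simp only [refresh]
    split_ifs
    · rw [trace_insertAt, trace_traceAt, hr, one_mul, ih]
    · exact ih

theorem posSemidef_refresh {r : Matrix X X ℂ} (hr : r.PosSemidef)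
    {W : Matrix (Fin (M + 1) → X) (Fin (M + 1) → X) ℂ} (hW : W.PosSemidef) (k : ℕ) :
    (refresh r W k).PosSemidef := by
  induction k with
  | zero => exact hW
  | succ k ih =>
    simp only [refresh]
    split_ifs
    · exact posSemidef_insertAt _ hr (posSemidef_traceAt _ ih)
    · exact ih

theorem insertAt_traceAt_tensorFamily (k : Fin (M + 1)) (r : Matrix X X ℂ)
    (m : Fin (M + 1) → Matrix X X ℂ) :
    insertAt k r (traceAt k (tensorFamily m)) =
      (m k).trace • tensorFamily (Function.update m k r) := by
  ext x y
  simp only [insertAt, traceAt, tensorFamily, Matrix.submatrix_apply, Matrix.kroneckerMap_apply,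
    Matrix.sum_apply, Matrix.of_apply, Matrix.smul_apply, smul_eq_mul]
  simp_rw [Fin.prod_univ_succAbove _ k]
  simp only [Fin.insertNth_apply_same, Fin.insertNth_apply_succAbove, Function.update_self,
    ne_eq, Fin.succAbove_ne, not_false_eq_true, Function.update_of_ne, Fin.removeNth]
  rw [← Finset.sum_mul, Matrix.trace]
  simp only [Matrix.diag_apply]
  ring

theorem refresh_tensorFamily (r : Matrix X X ℂ) (m : Fin (M + 1) → Matrix X X ℂ) (k : ℕ) :
    refresh r (tensorFamily m) k = (∏ j : Fin (M + 1), if (j : ℕ) < k then (m j).trace else 1) •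
      tensorFamily (fun j => if (j : ℕ) < k then r else m j) := by
  induction k with
  | zero => simp [refresh]
  | succ k ih =>
    simp only [refresh]
    split_ifs with h
    · rw [ih, traceAt_smul, insertAt_smul, insertAt_traceAt_tensorFamily, smul_smul]
      congr 1
      · rw [Fin.prod_univ_succAbove _ ⟨k, h⟩,
          Fin.prod_univ_succAbove (fun j : Fin (M + 1) => if (j : ℕ) < k + 1 then _ else _) ⟨k, h⟩]
        simp only [lt_self_iff_false, if_false, one_mul, Nat.lt_succ_self, if_true]
        rw [mul_comm]
        congr 1
        refine Finset.prod_congr rfl fun j _ => ?_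
        have : ((⟨k, h⟩ : Fin (M + 1)).succAbove j : ℕ) ≠ k := fun e =>
          Fin.succAbove_ne ⟨k, h⟩ j (Fin.ext e)
        have : ((⟨k, h⟩ : Fin (M + 1)).succAbove j : ℕ) < k + 1 ↔
          ((⟨k, h⟩ : Fin (M + 1)).succAbove j : ℕ) < k := by omega
        simp only [this]
      · congr 1
        ext1 j
        by_cases hj : j = ⟨k, h⟩
        · subst hj; simp
        · have : (j : ℕ) ≠ k := fun e => hj (Fin.ext e)
          have : (j : ℕ) < k + 1 ↔ (j : ℕ) < k := by omega
          simp [hj, this]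
    · rw [ih]
      have h1 : ∀ j : Fin (M + 1), (j : ℕ) < k := fun j => by omega
      have h2 : ∀ j : Fin (M + 1), (j : ℕ) < k + 1 := fun j => by omega
      simp [h1, h2]

/-- Once every position has been replaced, only the trace of `W` survives, whatever its
correlations. By linearity this needs checking only on matrix units, which are tensor products. -/
theorem refresh_all (r : Matrix X X ℂ)
    (W : Matrix (Fin (M + 1) → X) (Fin (M + 1) → X) ℂ) :
    refresh r W (M + 1) = W.trace • tensorFamily (fun _ => r) := by
  induction W using Matrix.induction_on' with
  | h_zero =>
    have := refresh_smul r 0 (0 : Matrix (Fin (M + 1) → X) (Fin (M + 1) → X) ℂ) (M + 1)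
    simpa using this
  | h_add p q hp hq => rw [refresh_add, hp, hq, Matrix.trace_add, add_smul]
  | h_std_basis i j c =>
    have h : Matrix.single i j c =
        c • tensorFamily (fun l => Matrix.single (i l) (j l) (1 : ℂ)) := by
      ext x y
      simp only [tensorFamily, Matrix.single_apply, Matrix.smul_apply, Matrix.of_apply,
        smul_eq_mul]
      by_cases hh : i = x ∧ j = y
      · simp [hh]
      · have : ∃ l, ¬ (i l = x l ∧ j l = y l) := by
          by_contra hcon
          push Not at hcon
          exact hh ⟨funext fun l => (hcon l).1, funext fun l => (hcon l).2⟩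
        obtain ⟨l, hl⟩ := this
        rw [if_neg hh, Finset.prod_eq_zero (Finset.mem_univ l) (if_neg hl), mul_zero]
    have h1 : ∀ l : Fin (M + 1), (l : ℕ) < M + 1 := fun l => l.2
    have ht : ∀ l : Fin (M + 1), (Matrix.single (i l) (j l) (1 : ℂ)).trace =
        if i l = j l then 1 else 0 := by
      intro l
      by_cases hl : i l = j l
      · simp [hl, Matrix.trace_single_eq_same]
      · simp [hl, Matrix.trace_single_eq_of_ne]
    have ht' : (Matrix.single i j c).trace = if i = j then c else 0 := by
      by_cases hl : i = j
      · simp [hl, Matrix.trace_single_eq_same]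
      · simp [hl, Matrix.trace_single_eq_of_ne]
    rw [ht', h, refresh_smul, refresh_tensorFamily, smul_smul]
    simp only [h1, if_true, ht]
    congr 1
    by_cases hij : i = j
    · simp [hij]
    · obtain ⟨l, hl⟩ := Function.ne_iff.1 hij
      rw [Finset.prod_eq_zero (Finset.mem_univ l) (if_neg hl), if_neg hij, mul_zero]

/-- After `k` replacements position `k` (counted from zero) still holds an uncorrelated copy of `s`.
This makes the ideal part of the chain drop out of the catalytic error. -/
theorem insertAt_traceAt_refresh (r : Matrix X X ℂ) {s : Matrix X X ℂ} (hs : s.trace = 1)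
    (k : Fin (M + 1)) :
    insertAt k s (traceAt k (refresh r (tensorFamily fun _ => s) k)) =
      refresh r (tensorFamily fun _ => s) k := by
  rw [refresh_tensorFamily]
  simp only [hs, ite_self, Finset.prod_const_one, one_smul]
  rw [insertAt_traceAt_tensorFamily]
  simp only [lt_self_iff_false, if_false, hs, one_smul]
  congr 1
  ext1 j
  by_cases hj : j = k
  · subst hj; simp
  · simp [hj]

theorem tensorFamily_const_succ (r : Matrix X X ℂ) (n : ℕ) :
    tensorFamily (fun _ : Fin (n + 1) => r) = insertAt 0 r (tensorFamily fun _ : Fin n => r) := by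
  ext x y
  simp [tensorFamily, insertAt, Fin.prod_univ_succ, Fin.tail]

theorem posSemidef_tensorFamily_const {r : Matrix X X ℂ} (hr : r.PosSemidef) (n : ℕ) :
    (tensorFamily fun _ : Fin n => r).PosSemidef := by
  induction n with
  | zero =>
    have : (tensorFamily fun _ : Fin 0 => r) = 1 := by
      ext x y
      obtain rfl := Subsingleton.elim x y
      simp [tensorFamily]
    rw [this]
    exact Matrix.PosSemidef.one
  | succ n ih => exact tensorFamily_const_succ r n ▸ posSemidef_insertAt _ hr ih

theorem trace_tensorFamily_const {r : Matrix X X ℂ} (hr : r.trace = 1) (n : ℕ) :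
    (tensorFamily fun _ : Fin n => r).trace = 1 := by
  induction n with
  | zero => simp [tensorFamily, Matrix.trace]
  | succ n ih => rw [tensorFamily_const_succ, trace_insertAt, hr, ih, one_mul]

end chain

open Matrix in
theorem posSemidef_blockDiagonal {Y K : Type} [Fintype Y] [Fintype K] [DecidableEq K]
    [DecidableEq Y] {V : K → Matrix Y Y ℂ} (hV : ∀ k, (V k).PosSemidef) :
    (blockDiagonal V).PosSemidef := by
  have h : blockDiagonal V = ∑ k, V k ⊗ₖ diagonal (Pi.single k (1 : ℂ)) := by
    ext ⟨x, k⟩ ⟨y, l⟩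
    simp only [Matrix.sum_apply, kroneckerMap_apply, blockDiagonal_apply, diagonal_apply]
    rw [Finset.sum_eq_single k]
    · simp
    · intro j _ hj
      simp [Ne.symm hj]
    · simp
  rw [h]
  refine posSemidef_sum _ fun k _ => (hV k).kronecker (PosSemidef.diagonal ?_)
  intro l
  by_cases hl : l = k
  · subst hl; simp
  · simp [hl]

/-! ### From many-copy conversion to catalysis. -/

section catalyst

variable {X A I J : Type} [Fintype X] [DecidableEq X] [Fintype I] [DecidableEq I]
  [Fintype J] [DecidableEq J] [Fintype A] [DecidableEq A] {M : ℕ}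

/-- Insert the system into position `k` of the catalyst, where `k` is the register. -/
def insertEquiv (X : Type) (M : ℕ) :
    X × ((Fin M → X) × Fin (M + 1)) ≃ (Fin (M + 1) → X) × Fin (M + 1) where
  toFun p := (p.2.2.insertNth (α := fun _ => X) p.1 p.2.1, p.2.2)
  invFun q := (q.1 q.2, (q.2.removeNth q.1, q.2))
  left_inv p := by simp
  right_inv q := by simp

/-- Increase the register; when it was full, apply the measurement `γ`. -/
def rotateLabel (γ : (Fin (M + 1) → X) → I × (Fin (M + 1) → X)) :
    (Fin (M + 1) → X) × Fin (M + 1) → Option I × ((Fin (M + 1) → X) × Fin (M + 1)) :=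
  fun q => if q.2 = Fin.last M then (some (γ q.1).1, ((γ q.1).2, q.2 + 1))
    else (none, (q.1, q.2 + 1))

theorem rotateLabel_injective {γ : (Fin (M + 1) → X) → I × (Fin (M + 1) → X)}
    (hγ : Function.Injective γ) : Function.Injective (rotateLabel γ) := by
  rintro ⟨x, k⟩ ⟨y, l⟩ h
  have hkl : k = l := by
    simp only [rotateLabel] at h
    split_ifs at h <;> simp_all
  subst hkl
  simp only [rotateLabel] at h
  split_ifs at h with hk
  · simp only [Prod.mk.injEq, Option.some.injEq, and_true] at h
    rw [hγ (Prod.ext h.1 h.2)]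
  · simpa using h

open Matrix in
-- The addition `q.2 + 1` is cyclic, so the full block is sent through `γ` and lands in block `0`,
-- while every other block moves up unchanged.
theorem labelChannel_rotateLabel (γ : (Fin (M + 1) → X) → I × (Fin (M + 1) → X))
    (V V' : Fin (M + 1) → Matrix (Fin (M + 1) → X) (Fin (M + 1) → X) ℂ)
    (h0 : V' 0 = labelChannel γ (V (Fin.last M)))
    (h1 : ∀ k : Fin M, V' k.succ = V k.castSucc) :
    labelChannel (rotateLabel γ) (blockDiagonal V) = blockDiagonal V' := by
  have hrot : ∀ x : Fin (M + 1) → X, ∀ k : Fin M,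
      rotateLabel γ (x, k.castSucc) = (none, (x, k.succ)) := by
    intro x k
    have : k.castSucc ≠ Fin.last M := (Fin.castSucc_lt_last k).ne
    simp [rotateLabel, this]
  have hlast : ∀ x : Fin (M + 1) → X,
      rotateLabel γ (x, Fin.last M) = (some (γ x).1, ((γ x).2, 0)) := by
    intro x
    simp [rotateLabel]
  ext ⟨z, k⟩ ⟨w, l⟩
  rw [labelChannel_apply]
  simp only [Fintype.sum_prod_type]
  simp only [Fin.sum_univ_castSucc, hrot, hlast, blockDiagonal_apply]
  have hc : ∀ j : Fin M, j.castSucc ≠ Fin.last M := fun j => (Fin.castSucc_lt_last j).ne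
  simp only [hc, (hc _).symm, if_false, Prod.mk.injEq, ite_self, Finset.sum_const_zero, add_zero,
    reduceCtorEq, and_false, Option.some.injEq, if_true, zero_add, Fin.castSucc_inj, and_true]
  rw [Finset.sum_add_distrib]
  by_cases hkl : k = l
  · subst hkl
    rw [if_pos rfl]
    refine Fin.cases ?_ (fun k => ?_) k
    · rw [h0, labelChannel_apply]
      simp [Fin.succ_ne_zero]
    · rw [h1]
      have : ∀ j : Fin M, (0 : Fin (M + 1)) ≠ j.succ := fun j => (Fin.succ_ne_zero j).symm
      simp only [this, and_false, false_and, if_false, Finset.sum_const_zero, add_zero,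
        Fin.succ_inj]
      rw [Finset.sum_eq_single z, Finset.sum_eq_single k, Finset.sum_eq_single w,
        Finset.sum_eq_single k]
      all_goals simp +contextual
  · rw [if_neg hkl]
    rw [Finset.sum_eq_zero, Finset.sum_eq_zero, add_zero]
    · intro x _
      refine Finset.sum_eq_zero fun y _ => ?_
      rw [if_neg]
      rintro ⟨⟨-, h⟩, ⟨-, h'⟩, -⟩
      exact hkl (h.symm.trans h')
    · intro x _
      refine Finset.sum_eq_zero fun j _ => Finset.sum_eq_zero fun y _ =>
        Finset.sum_eq_zero fun j' _ => ?_
      split_ifs with h h'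
      · obtain ⟨⟨-, h2⟩, ⟨-, h3⟩⟩ := h
        exact absurd (h2.symm.trans ((congrArg Fin.succ h').trans h3)) hkl
      · rfl
      · rfl

theorem traceLeft_submatrix_insertEquiv
    (V : Fin (M + 1) → Matrix (Fin (M + 1) → X) (Fin (M + 1) → X) ℂ) :
    traceLeft ((Matrix.blockDiagonal V).submatrix (insertEquiv X M) (insertEquiv X M)) =
      Matrix.blockDiagonal (fun k => traceAt k (V k)) := by
  ext ⟨u, k⟩ ⟨v, l⟩
  simp only [traceLeft, Matrix.sum_apply, Matrix.submatrix_apply, insertEquiv, Equiv.coe_fn_mk,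
    Matrix.blockDiagonal_apply, traceAt]
  by_cases h : k = l
  · subst h; simp
  · simp [h]

theorem kronecker_blockDiagonal_submatrix (r : Matrix X X ℂ)
    (T : Fin (M + 1) → Matrix (Fin M → X) (Fin M → X) ℂ) :
    r ⊗ₖ Matrix.blockDiagonal T =
      (Matrix.blockDiagonal fun k => insertAt k r (T k)).submatrix
        (insertEquiv X M) (insertEquiv X M) := by
  ext ⟨a, u, k⟩ ⟨b, v, l⟩
  simp only [Matrix.kroneckerMap_apply, Matrix.submatrix_apply, insertEquiv, Equiv.coe_fn_mk,
    Matrix.blockDiagonal_apply, insertAt]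
  by_cases h : k = l
  · subst h; simp
  · simp [h]

/-- Apply a measurement to the left factor. -/
def labelLeft {C : Type} (f : X → J × A) : X × C → J × (A × C) :=
  fun p => ((f p.1).1, ((f p.1).2, p.2))

theorem labelLeft_injective {C : Type} {f : X → J × A} (hf : Function.Injective f) :
    Function.Injective (labelLeft (C := C) f) := by
  rintro ⟨x, c⟩ ⟨y, d⟩ h
  simp only [labelLeft, Prod.mk.injEq] at h
  exact Prod.ext (hf (Prod.ext h.1 h.2.1)) h.2.2

/-- A trace-preserving operation on the discarded factor does not affect the remaining one; the
final relabelling of the system therefore cannot disturb the catalyst. -/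
theorem traceLeft_labelLeft {C : Type} [Fintype C] [DecidableEq C] {f : X → J × A}
    (hf : Function.Injective f) (R : Matrix (X × C) (X × C) ℂ) :
    traceLeft (labelChannel (labelLeft f) R) = traceLeft R := by
  ext c d
  simp only [traceLeft, Matrix.sum_apply, Matrix.submatrix_apply, labelChannel_apply,
    Fintype.sum_prod_type, labelLeft, Prod.mk.injEq]
  have h : ∀ a : A, (∑ x, ∑ c', ∑ y, ∑ d', if ((f x).2 = a ∧ c' = c) ∧ ((f y).2 = a ∧ d' = d) ∧
      (f x).1 = (f y).1 then R (x, c') (y, d') else 0) =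
      ∑ x, if (f x).2 = a then R (x, c) (x, d) else 0 := by
    intro a
    refine Finset.sum_congr rfl fun x _ => ?_
    rw [Finset.sum_eq_single c, Finset.sum_eq_single x, Finset.sum_eq_single d]
    · simp
    · intro d' _ hd
      simp [hd]
    · simp
    · intro y _ hy
      refine Finset.sum_eq_zero fun d' _ => ?_
      rw [if_neg]
      rintro ⟨⟨h1, -⟩, ⟨h2, -⟩, h3⟩
      exact hy (hf (Prod.ext h3.symm (h2.trans h1.symm)))
    · simp
    · intro c' _ hc
      simp [hc]
    · simp
  rw [Finset.sum_congr rfl fun a _ => h a, Finset.sum_comm]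
  simp

theorem labelChannel_labelLeft_kronecker {C : Type} [Fintype C] [DecidableEq C] (f : X → J × A)
    (s : Matrix X X ℂ) (S : Matrix C C ℂ) :
    labelChannel (labelLeft f) (s ⊗ₖ S) = labelChannel f s ⊗ₖ S := by
  ext ⟨a, c⟩ ⟨b, d⟩
  simp only [Matrix.kroneckerMap_apply, labelChannel_apply,
    Fintype.sum_prod_type, labelLeft, Prod.mk.injEq, Finset.sum_mul]
  refine Finset.sum_congr rfl fun x _ => ?_
  rw [Finset.sum_eq_single c]
  · refine Finset.sum_congr rfl fun y _ => ?_
    rw [Finset.sum_eq_single d]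
    · by_cases h : (f x).2 = a ∧ (f y).2 = b ∧ (f x).1 = (f y).1 <;> simp [h]
    · intro d' _ hd
      simp [hd]
    · simp
  · intro c' _ hc
    simp [hc]
  · simp

/-- If a measurement turns many copies of `r` into many copies of `s` with an error of weight
`B.trace`, then there is a catalyst enabling the conversion of a single copy. -/
theorem exists_catalyst {r s : Matrix X X ℂ} (hr : r.PosSemidef) (hr1 : r.trace = 1)
    (hs : s.PosSemidef) (hs1 : s.trace = 1) {f : X → J × A} (hf : Function.Injective f)
    {γ : (Fin (M + 1) → X) → I × (Fin (M + 1) → X)} (hγ : Function.Injective γ)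
    {B : Matrix (Fin (M + 1) → X) (Fin (M + 1) → X) ℂ} (hB : B.PosSemidef) {c : ℂ}
    (h : labelChannel γ (tensorFamily fun _ => r) = c • tensorFamily (fun _ => s) + B) :
    ∃ (C L : Type) (_ : Fintype C) (_ : DecidableEq C) (_ : Fintype L) (_ : DecidableEq L)
      (S : Matrix C C ℂ) (F : X × C → L × (A × C)),
      IsDensity S ∧ Function.Injective F ∧ traceLeft (labelChannel F (r ⊗ₖ S)) = S ∧
      ∃ P Q : Matrix (A × C) (A × C) ℂ, P.PosSemidef ∧ Q.PosSemidef ∧ P.trace = B.trace ∧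
        Q.trace = B.trace ∧ labelChannel F (r ⊗ₖ S) - labelChannel f s ⊗ₖ S = P - Q := by
  set σ := labelChannel γ (tensorFamily fun _ => r) with hσ
  have hσp : σ.PosSemidef := posSemidef_labelChannel _ (posSemidef_tensorFamily_const hr _)
  have hσ1 : σ.trace = 1 := by rw [hσ, trace_labelChannel hγ, trace_tensorFamily_const hr1]
  -- The uniform weight of the `M + 1` values of the register.
  set a : ℂ := (((M + 1 : ℝ)⁻¹ : ℝ) : ℂ) with ha
  have ha0 : 0 ≤ a := by
    rw [ha]
    exact Complex.zero_le_real.2 (by positivity)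
  have haM : (M + 1 : ℂ) * a = 1 := by
    have : (M + 1 : ℂ) ≠ 0 := by exact_mod_cast Nat.succ_ne_zero M
    rw [ha]
    push_cast
    exact mul_inv_cancel₀ this
  -- With register value `k`, the catalyst is the converted chain `σ` with its first `k` systems
  -- replaced by `r` and position `k` missing.
  set S := Matrix.blockDiagonal fun k : Fin (M + 1) => a • traceAt k (refresh r σ k) with hS
  have htr : ∀ V : Fin (M + 1) → Matrix (Fin (M + 1) → X) (Fin (M + 1) → X) ℂ, ∀ t : ℂ,
      (∀ k, (V k).trace = t) →
      ((Matrix.blockDiagonal fun k => a • V k).submatrix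
        (insertEquiv X M) (insertEquiv X M)).trace = t := by
    intro V t ht
    have h1 : ((Matrix.blockDiagonal fun k => a • V k).submatrix
        (insertEquiv X M) (insertEquiv X M)).trace =
        (Matrix.blockDiagonal fun k => a • V k).trace :=
      (insertEquiv X M).sum_comp fun p => (Matrix.blockDiagonal fun k => a • V k) p p
    rw [h1, Matrix.trace_blockDiagonal]
    simp only [Matrix.trace_smul, ht, Finset.sum_const, Finset.card_univ, Fintype.card_fin,
      nsmul_eq_mul, smul_eq_mul]
    push_cast
    rw [← mul_assoc, haM, one_mul]
  have hpos : ∀ V : Fin (M + 1) → Matrix (Fin (M + 1) → X) (Fin (M + 1) → X) ℂ,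
      (∀ k, (V k).PosSemidef) →
      ((Matrix.blockDiagonal fun k => a • V k).submatrix
        (insertEquiv X M) (insertEquiv X M)).PosSemidef :=
    fun V hV => (posSemidef_blockDiagonal fun k => (hV k).smul ha0).submatrix _
  have hSd : IsDensity S := by
    refine ⟨posSemidef_blockDiagonal fun k =>
      (posSemidef_traceAt k (posSemidef_refresh hr hσp k)).smul ha0, ?_⟩
    rw [hS, Matrix.trace_blockDiagonal]
    simp only [Matrix.trace_smul, trace_traceAt, trace_refresh hr1, hσ1, Finset.sum_const,
      Finset.card_univ, Fintype.card_fin, nsmul_eq_mul, smul_eq_mul]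
    push_cast
    rw [mul_one, haM]
  -- Read from the inside: put the input into the gap, advance the register (converting a full chain
  -- by `γ`), take out the system at the new register position, and apply `f` to it.
  set F := labelComp (labelLeft f) (labelComp (equivLabel (insertEquiv X M).symm)
    (labelComp (rotateLabel γ) (equivLabel (insertEquiv X M)))) with hF
  -- Filling the gap at `k` with `r` yields the chain of the next register value, so advancing the
  -- register reproduces the same mixture.
  have hins : ∀ k : Fin (M + 1), insertAt k r (a • traceAt k (refresh r σ k)) =
      a • refresh r σ (k + 1) := fun k => by rw [insertAt_smul, refresh_succ]
  have hout : labelChannel F (r ⊗ₖ S) = labelChannel (labelLeft f)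
      ((Matrix.blockDiagonal fun k : Fin (M + 1) => a • refresh r σ k).submatrix
        (insertEquiv X M) (insertEquiv X M)) := by
    rw [hF, labelChannel_labelComp, labelChannel_labelComp, labelChannel_labelComp,
      labelChannel_equivLabel, labelChannel_equivLabel, hS, kronecker_blockDiagonal_submatrix,
      Matrix.submatrix_submatrix]
    simp only [Equiv.self_comp_symm, Matrix.submatrix_id_id, Equiv.symm_symm, hins]
    rw [labelChannel_rotateLabel γ _ (fun k : Fin (M + 1) => a • refresh r σ k)]
    -- At the last register value the filled chain consists of `M + 1` copies of `r`, which `γ`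
    -- turns back into `σ`, the chain for register `0`.
    · have h1 : refresh r σ ((Fin.last M : ℕ) + 1) = tensorFamily fun _ => r := by
        rw [Fin.val_last, refresh_all, hσ1, one_smul]
      rw [h1, labelChannel_smul, ← hσ]
      rfl
    · intro k
      rw [Fin.val_succ, Fin.val_castSucc]
  refine ⟨_, _, inferInstance, inferInstance, inferInstance, inferInstance, S, F, hSd, ?_, ?_,
    labelChannel (labelLeft f) ((Matrix.blockDiagonal fun k : Fin (M + 1) =>
      a • refresh r B k).submatrix (insertEquiv X M) (insertEquiv X M)),
    labelChannel (labelLeft f) ((Matrix.blockDiagonal fun k : Fin (M + 1) =>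
      a • insertAt k s (traceAt k (refresh r B k))).submatrix
        (insertEquiv X M) (insertEquiv X M)), ?_, ?_, ?_, ?_, ?_⟩
  · exact labelComp_injective (labelLeft_injective hf) (labelComp_injective
      (equivLabel_injective _) (labelComp_injective (rotateLabel_injective hγ)
        (equivLabel_injective _)))
  · rw [hout, traceLeft_labelLeft hf, traceLeft_submatrix_insertEquiv]
    simp only [traceAt_smul, hS]
  · exact posSemidef_labelChannel _ (hpos _ fun k => posSemidef_refresh hr hB k)
  · exact posSemidef_labelChannel _ (hpos _ fun k => posSemidef_insertAt _ hs
      (posSemidef_traceAt _ (posSemidef_refresh hr hB k)))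
  · rw [trace_labelChannel (labelLeft_injective hf)]
    exact htr _ _ fun k => trace_refresh hr1 B k
  · rw [trace_labelChannel (labelLeft_injective hf)]
    refine htr _ _ fun k => ?_
    rw [trace_insertAt, hs1, one_mul, trace_traceAt, trace_refresh hr1]
  · rw [hout, ← labelChannel_labelLeft_kronecker, hS, kronecker_blockDiagonal_submatrix,
      ← labelChannel_sub, ← labelChannel_sub]
    congr 1
    ext p q
    simp only [Matrix.sub_apply, Matrix.submatrix_apply, Matrix.blockDiagonal_apply]
    split_ifs
    -- The part `c • s ⊗ ⋯ ⊗ s` of `σ` cancels in the difference, leaving two positive terms built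
    -- from `B` alone.
    · have key : ∀ k : Fin (M + 1), refresh r σ k - insertAt k s (traceAt k (refresh r σ k)) =
          refresh r B k - insertAt k s (traceAt k (refresh r B k)) := by
        intro k
        rw [h, refresh_add, refresh_smul, traceAt_add, insertAt_add, traceAt_smul, insertAt_smul,
          insertAt_traceAt_refresh r hs1]
        abel
      have := congrFun (congrFun (key (insertEquiv X M p).2) (insertEquiv X M p).1)
        (insertEquiv X M q).1
      simp only [Matrix.sub_apply] at this
      simp only [insertAt_smul, Matrix.smul_apply, smul_eq_mul, ← mul_sub, this]
    · rfl

end catalyst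

/-! ### Entanglement concentration with an explicit error. -/

section concentration

variable {Y T D : Type} [Fintype Y] [DecidableEq Y] [Fintype T] [DecidableEq T]
  [Fintype D] [DecidableEq D]

theorem labelChannel_pureState {I Z : Type} [Fintype I] [DecidableEq I] [DecidableEq Z]
    (F : Y → I × Z) (v : Y → ℂ) :
    labelChannel F (pureState v) = ∑ i, pureState ((labelKraus F i).mulVec v) := by
  refine Finset.sum_congr rfl fun i _ => ?_
  rw [pureState, pureState, Matrix.mul_vecMulVec, Matrix.vecMulVec_mul, Matrix.star_mulVec]

/-- The elements of each fibre of `t` can be numbered. -/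
theorem exists_fiber_numbering (t : Y → T) :
    ∃ pos : Y → ℕ, (∀ y, pos y < (Finset.univ.filter fun x => t x = t y).card) ∧
      (∀ x y, t x = t y → pos x = pos y → x = y) ∧
      ∀ τ, ∀ j < (Finset.univ.filter fun x => t x = τ).card, ∃ y, t y = τ ∧ pos y = j := by
  let e := fun τ => (Finset.univ.filter fun x => t x = τ).equivFin
  have hm : ∀ y, y ∈ Finset.univ.filter fun x => t x = t y := fun y => by simp
  have key : ∀ τ x (hx : x ∈ Finset.univ.filter fun x => t x = τ),
      (e (t x) ⟨x, hm x⟩ : ℕ) = e τ ⟨x, hx⟩ := by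
    intro τ x hx
    obtain rfl : t x = τ := by simpa using hx
    rfl
  refine ⟨fun y => e (t y) ⟨y, hm y⟩, fun y => (e (t y) ⟨y, hm y⟩).2, ?_, ?_⟩
  · intro x y hxy h
    have hx : x ∈ Finset.univ.filter fun x => t x = t y := by simp [hxy]
    simp only [key (t y) x hx] at h
    have := (e (t y)).injective (Fin.ext h)
    exact congrArg Subtype.val this
  · intro τ j hj
    let z := (e τ).symm ⟨j, hj⟩
    have hz : t z = τ := (Finset.mem_filter.1 z.2).2
    refine ⟨z, hz, ?_⟩
    simp only [key τ z z.2]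
    simp [z]

/-- Entanglement concentration: the measurement of the type `t`, after which the coefficients are
equal, followed by cutting into blocks of the size of `D`. -/
theorem exists_concentration (t : Y → T) (μ : T → ℝ) (hμ : ∀ τ, 0 ≤ μ τ)
    (hsum : ∑ y, μ (t y) = 1) [Nonempty D] (ι : D ↪ Y) :
    ∃ (I : Type) (_ : Fintype I) (_ : DecidableEq I) (γ : Y → I × Y) (B : Matrix Y Y ℂ) (c : ℂ),
      Function.Injective γ ∧ B.PosSemidef ∧
      labelChannel γ (pureState fun y => ((Real.sqrt (μ (t y)) : ℝ) : ℂ)) =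
        c • (Matrix.of fun x y => if x ∈ Set.range ι ∧ y ∈ Set.range ι
          then ((Fintype.card D : ℂ))⁻¹ else 0) + B ∧
      B.trace.re = ∑ τ, μ τ *
        ((Finset.univ.filter fun y => t y = τ).card % Fintype.card D : ℕ) := by
  classical
  obtain ⟨pos, hlt, hinj, hsurj⟩ := exists_fiber_numbering t
  set d := Fintype.card D with hd
  have hd0 : 0 < d := Fintype.card_pos
  set size : T → ℕ := fun τ => (Finset.univ.filter fun y => t y = τ).card with hsize
  have hsizeY : ∀ τ, size τ ≤ Fintype.card Y := fun τ => Finset.card_le_univ _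
  have hq : ∀ y, pos y / d < Fintype.card Y + 1 := fun y =>
    (Nat.div_le_self _ _).trans_lt ((hlt y).trans_le ((hsizeY _).trans (Nat.le_succ _)))
  -- Each type class is numbered and cut into blocks of length `d`. The outcome is the type and the
  -- block number; the position within the block is kept as an element of `D`.
  let γ : Y → (T × Fin (Fintype.card Y + 1)) × Y := fun y =>
    ((t y, ⟨pos y / d, hq y⟩), ι ((Fintype.equivFin D).symm ⟨pos y % d, Nat.mod_lt _ hd0⟩))
  have hγ : Function.Injective γ := by
    intro x y h
    simp only [γ, Prod.mk.injEq, Fin.mk.injEq, EmbeddingLike.apply_eq_iff_eq] at h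
    refine hinj x y h.1.1 ?_
    rw [← Nat.div_add_mod (pos x) d, ← Nat.div_add_mod (pos y) d, h.1.2, h.2]
  set v : Y → ℂ := fun y => ((Real.sqrt (μ (t y)) : ℝ) : ℂ) with hv
  let full : Finset (T × Fin (Fintype.card Y + 1)) :=
    Finset.univ.filter fun i => i.2 * d + d ≤ size i.1
  let E : Matrix Y Y ℂ := Matrix.of fun x y => if x ∈ Set.range ι ∧ y ∈ Set.range ι
    then (d : ℂ)⁻¹ else 0
  -- A complete block meets every element of `range ι` exactly once with the same coefficient, hence
  -- is proportional to the target.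
  have hfull : ∀ i ∈ full, pureState ((labelKraus γ i).mulVec v) = ((μ i.1 * d : ℝ) : ℂ) • E := by
    rintro ⟨τ, q⟩ hi
    have hi' : (q : ℕ) * d + d ≤ size τ := by simpa [full] using hi
    have hu : (labelKraus γ (τ, q)).mulVec v =
        fun z => if z ∈ Set.range ι then ((Real.sqrt (μ τ) : ℝ) : ℂ) else 0 := by
      ext z
      simp only [Matrix.mulVec, dotProduct, labelKraus, Matrix.of_apply, ite_mul, one_mul,
        zero_mul]
      split_ifs with hz
      · obtain ⟨j, rfl⟩ := hz
        have hj : (Fintype.equivFin D j : ℕ) < d := (Fintype.equivFin D j).2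
        obtain ⟨y, hy, hyp⟩ := hsurj τ (q * d + Fintype.equivFin D j) (by
          change _ < size τ
          omega)
        have hγy : γ y = ((τ, q), ι j) := by
          simp only [γ, Prod.mk.injEq, EmbeddingLike.apply_eq_iff_eq, hyp]
          refine ⟨⟨hy, Fin.ext ?_⟩, ?_⟩
          · simp only
            rw [mul_comm, Nat.mul_add_div hd0, Nat.div_eq_of_lt hj, add_zero]
          · rw [Equiv.symm_apply_eq]
            refine Fin.ext ?_
            simp only
            rw [mul_comm, Nat.mul_add_mod, Nat.mod_eq_of_lt hj]
        rw [Finset.sum_eq_single y]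
        · rw [if_pos hγy, hv]
          simp only [hy]
        · intro y' _ hy'
          rw [if_neg]
          intro h
          exact hy' (hγ (h.trans hγy.symm))
        · simp
      · refine Finset.sum_eq_zero fun y _ => ?_
        rw [if_neg]
        intro h
        exact hz ⟨_, congrArg Prod.snd h⟩
    ext x y
    simp only [pureState, hu, Matrix.vecMulVec_apply, Pi.star_apply, Matrix.smul_apply, E,
      Matrix.of_apply, smul_eq_mul]
    by_cases hx : x ∈ Set.range ι <;> by_cases hy : y ∈ Set.range ι
    · have hd1 : (d : ℂ) ≠ 0 := by exact_mod_cast hd0.ne'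
      simp only [hx, hy, if_true, and_self]
      rw [Complex.ofReal_mul, Complex.ofReal_natCast, mul_assoc, mul_inv_cancel₀ hd1, mul_one]
      rw [Complex.star_def, Complex.conj_ofReal, ← Complex.ofReal_mul,
        Real.mul_self_sqrt (hμ τ)]
    · simp [hx, hy]
    · simp [hx, hy]
    · simp [hx, hy]
  refine ⟨_, inferInstance, inferInstance, γ,
    ∑ i ∈ fullᶜ, pureState ((labelKraus γ i).mulVec v), ((∑ i ∈ full, μ i.1 * d : ℝ) : ℂ), hγ,
    Matrix.posSemidef_sum _ fun i _ => Matrix.posSemidef_vecMulVec_self_star _, ?_, ?_⟩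
  · rw [labelChannel_pureState, ← Finset.sum_add_sum_compl full, Finset.sum_congr rfl hfull,
      Complex.ofReal_sum, Finset.sum_smul]
  -- The incomplete blocks carry what the complete ones leave of the total trace `1`: in each class,
  -- the remainder of its size modulo `d`.
  · have htr := congrArg Matrix.trace (labelChannel_pureState γ v)
    rw [trace_labelChannel hγ, ← Finset.sum_add_sum_compl full, Finset.sum_congr rfl hfull,
      Matrix.trace_add, Matrix.trace_sum] at htr
    have hE : E.trace = 1 := by
      have hd1 : (d : ℂ) ≠ 0 := by exact_mod_cast hd0.ne'
      simp only [Matrix.trace, Matrix.diag_apply, E, Matrix.of_apply, and_self]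
      rw [← Finset.sum_filter, Finset.sum_const]
      have : (Finset.univ.filter fun x => x ∈ Set.range ι) = Finset.univ.map ι := by
        ext x
        simp
      rw [this, Finset.card_map, Finset.card_univ, nsmul_eq_mul, ← hd, mul_inv_cancel₀ hd1]
    simp only [Matrix.trace_smul, hE, smul_eq_mul, mul_one] at htr
    have hv1 : (pureState v).trace = 1 := by
      simp only [Matrix.trace, Matrix.diag_apply, pureState, Matrix.vecMulVec_apply, Pi.star_apply,
        hv, Complex.star_def, Complex.conj_ofReal, ← Complex.ofReal_mul, ← Complex.ofReal_sum,
        Real.mul_self_sqrt (hμ _), hsum, Complex.ofReal_one]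
    rw [hv1, ← Complex.ofReal_sum] at htr
    have htr' := congrArg Complex.re htr
    rw [Complex.add_re, Complex.ofReal_re, Complex.one_re] at htr'
    have hsum' : (1 : ℝ) = ∑ τ, size τ * μ τ := by
      rw [← hsum, ← Finset.sum_fiberwise Finset.univ t]
      refine Finset.sum_congr rfl fun τ _ => ?_
      rw [Finset.sum_congr rfl (g := fun _ => μ τ) (by simp +contextual), Finset.sum_const,
        nsmul_eq_mul]
    have hcount : ∑ i ∈ full, μ i.1 * d = ∑ τ, μ τ * d * (size τ / d : ℕ) := by
      simp only [full, Finset.sum_filter, Fintype.sum_prod_type]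
      refine Finset.sum_congr rfl fun τ _ => ?_
      rw [← Finset.sum_filter, Finset.sum_const, nsmul_eq_mul, mul_comm]
      congr 2
      have h1 : (Finset.univ.filter fun q : Fin (Fintype.card Y + 1) => (q : ℕ) * d + d ≤ size τ) =
          Finset.univ.filter fun q : Fin (Fintype.card Y + 1) => (q : ℕ) < size τ / d := by
        ext q
        simp only [Finset.mem_filter, Finset.mem_univ, true_and]
        rw [Nat.lt_iff_add_one_le, Nat.le_div_iff_mul_le hd0, add_mul, one_mul]
      rw [h1, Fin.card_filter_val_lt]
      exact min_eq_right ((Nat.div_le_self _ _).trans ((hsizeY τ).trans (Nat.le_succ _)))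
    have : ∑ τ, μ τ * (size τ % d : ℕ) = ∑ τ, size τ * μ τ - ∑ τ, μ τ * d * (size τ / d : ℕ) := by
      rw [← Finset.sum_sub_distrib]
      refine Finset.sum_congr rfl fun τ _ => ?_
      have := congrArg (Nat.cast (R := ℝ)) (Nat.div_add_mod (size τ) d)
      push_cast at this ⊢
      rw [← this]
      ring
    rw [this, ← hsum', ← hcount, htr']
    ring

/-- A tail bound for the weight lost in entanglement concentration. -/
theorem sum_mod_card_le (t : Y → T) (μ : T → ℝ) (hμ : ∀ τ, 0 ≤ μ τ) {d : ℕ} (hd : 0 < d)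
    {θ s : ℝ} (hθ : 0 < θ) (hs : 0 < s) :
    ∑ τ, μ τ * ((Finset.univ.filter fun y => t y = τ).card % d : ℕ) ≤
      Fintype.card T * (d * θ) + θ ^ (-s) * ∑ y, μ (t y) ^ (1 + s) := by
  have h1 : (Fintype.card T : ℝ) * (d * θ) = ∑ _τ : T, d * θ := by simp
  rw [h1, ← Finset.sum_fiberwise Finset.univ t, Finset.mul_sum, ← Finset.sum_add_distrib]
  refine Finset.sum_le_sum fun τ _ => ?_
  have h2 : ∑ y with t y = τ, μ (t y) ^ (1 + s) =
      (Finset.univ.filter fun y => t y = τ).card * μ τ ^ (1 + s) := by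
    rw [Finset.sum_congr rfl (g := fun _ => μ τ ^ (1 + s)) (by simp +contextual), Finset.sum_const,
      nsmul_eq_mul]
  rw [h2]
  set n := (Finset.univ.filter fun y => t y = τ).card
  -- For light types the remainder is bounded by `d`; for heavy types the whole class is bounded,
  -- with the Markov factor `(μ τ / θ) ^ s ≥ 1`.
  by_cases h : μ τ ≤ θ
  · have a1 : ((n % d : ℕ) : ℝ) ≤ d := by exact_mod_cast (Nat.mod_lt _ hd).le
    have a2 : μ τ * (n % d : ℕ) ≤ d * θ := by
      rw [mul_comm]
      exact mul_le_mul a1 h (hμ τ) (by positivity)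
    have a3 : 0 ≤ θ ^ (-s) * (n * μ τ ^ (1 + s)) :=
      mul_nonneg (Real.rpow_nonneg hθ.le _)
        (mul_nonneg (Nat.cast_nonneg _) (Real.rpow_nonneg (hμ τ) _))
    linarith
  · push Not at h
    have hp : 0 < μ τ := hθ.trans h
    have a1 : ((n % d : ℕ) : ℝ) ≤ n := by exact_mod_cast Nat.mod_le _ _
    have a2 : 1 ≤ θ ^ (-s) * μ τ ^ s := by
      rw [Real.rpow_neg hθ.le, ← div_eq_inv_mul, one_le_div (Real.rpow_pos_of_pos hθ _)]
      exact Real.rpow_le_rpow hθ.le h.le hs.le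
    have a3 : μ τ * n ≤ θ ^ (-s) * (n * μ τ ^ (1 + s)) := by
      rw [Real.rpow_add hp, Real.rpow_one]
      have : θ ^ (-s) * (n * (μ τ * μ τ ^ s)) = (μ τ * n) * (θ ^ (-s) * μ τ ^ s) := by ring
      rw [this]
      exact le_mul_of_one_le_right (by positivity) a2
    have a4 : μ τ * (n % d : ℕ) ≤ μ τ * n := mul_le_mul_of_nonneg_left a1 (hμ τ)
    have a5 : 0 ≤ (d : ℝ) * θ := by positivity
    linarith

end concentration

/-! ### Schmidt weights and their power sums. -/

/-- The squared Schmidt coefficients of a product of two-qubit states. -/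
def schmidtWeight (p : ℕ → ℝ) (n : ℕ) (x : Fin n → Fin 2) : ℝ :=
  ∏ i, if x i = 0 then 1 - p i else p i

theorem pureState_diagonal {X : Type} [DecidableEq X] (v : X → ℂ) :
    pureState (fun q : X × X => if q.1 = q.2 then v q.1 else 0) = maxCorrelated (pureState v) := by
  ext p q
  simp only [pureState, maxCorrelated, Matrix.vecMulVec_apply, Matrix.of_apply, Pi.star_apply]
  by_cases h1 : p.1 = p.2 <;> by_cases h2 : q.1 = q.2 <;> simp [h1, h2]

theorem productState_diagonal (v : ℕ → Fin 2 → ℂ) (n : ℕ) :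
    productState (fun i q => if q.1 = q.2 then v i q.1 else 0) n =
      fun q => if q.1 = q.2 then ∏ i : Fin n, v i (q.1 i) else 0 := by
  ext q
  simp only [productState]
  split_ifs with h
  · exact Finset.prod_congr rfl fun i _ => if_pos (congrFun h i)
  · obtain ⟨i, hi⟩ := Function.ne_iff.1 h
    exact Finset.prod_eq_zero (Finset.mem_univ i) (if_neg hi)

theorem twoQubitState_eq (p : ℝ) : twoQubitState p = fun q => if q.1 = q.2 then
    ((Real.sqrt (if q.1 = 0 then 1 - p else p) : ℝ) : ℂ) else 0 := by
  ext ⟨a, b⟩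
  fin_cases a <;> fin_cases b <;> simp [twoQubitState]

section weights

variable {p : ℕ → ℝ}

theorem schmidtWeight_pos (hp : ∀ i, 0 < p i ∧ p i < 1) (n : ℕ) (x : Fin n → Fin 2) : 0 < schmidtWeight p n x := by
  refine Finset.prod_pos fun i _ => ?_
  split_ifs
  · linarith [(hp i).2]
  · exact (hp i).1

/-- Stated for a multiplicative `φ` in order to cover both normalization (`id`) and power sums (`y ^
(1 + s)`). -/
theorem sum_schmidtWeight_comp (φ : ℝ → ℝ) (hφ : ∀ n (f : Fin n → ℝ), (∀ i, 0 ≤ f i) →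
    φ (∏ i, f i) = ∏ i, φ (f i)) (hp0 : ∀ i, 0 ≤ p i ∧ p i ≤ 1) (n : ℕ) :
    ∑ x, φ (schmidtWeight p n x) = ∏ i : Fin n, (φ (1 - p i) + φ (p i)) := by
  have h : ∀ x : Fin n → Fin 2, φ (schmidtWeight p n x) =
      ∏ i, φ (if x i = 0 then 1 - p i else p i) := by
    intro x
    refine hφ n _ fun i => ?_
    split_ifs
    · linarith [(hp0 i).2]
    · exact (hp0 i).1
  simp only [h]
  rw [← Fintype.prod_sum (fun (i : Fin n) (a : Fin 2) => φ (if a = 0 then 1 - p i else p i))]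
  simp [Fin.sum_univ_two]

theorem sum_schmidtWeight (hp : ∀ i, 0 < p i ∧ p i < 1) (n : ℕ) : ∑ x, schmidtWeight p n x = 1 := by
  have := sum_schmidtWeight_comp (p := p) id (fun _ _ _ => rfl)
    (fun i => ⟨(hp i).1.le, (hp i).2.le⟩) n
  simpa using this

theorem productState_twoQubitState (hp : ∀ i, 0 < p i ∧ p i < 1) (n : ℕ) :
    productState (fun i => twoQubitState (p i)) n = fun q => if q.1 = q.2 then
      ((Real.sqrt (schmidtWeight p n q.1) : ℝ) : ℂ) else 0 := by
  simp only [twoQubitState_eq]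
  rw [productState_diagonal (fun i a => ((Real.sqrt (if a = 0 then 1 - p i else p i) : ℝ) : ℂ))]
  ext q
  congr 1
  rw [schmidtWeight, Real.sqrt_prod, Complex.ofReal_prod]
  intro i _
  split_ifs
  · linarith [(hp i).2]
  · exact (hp i).1.le

theorem pureState_productState_singlet (m : ℕ) :
    pureState (productState (fun _ => singlet) m) =
      maxCorrelated (Matrix.of fun _ _ : Fin m → Fin 2 => ((2 : ℂ) ^ m)⁻¹) := by
  have h : (fun _ : ℕ => singlet) = fun _ q => if q.1 = q.2 then
      (fun (_ : ℕ) (_ : Fin 2) => ((1 / Real.sqrt 2 : ℝ) : ℂ)) 0 q.1 else 0 := rfl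
  rw [h, productState_diagonal (fun _ _ => ((1 / Real.sqrt 2 : ℝ) : ℂ)),
    pureState_diagonal (fun _ => ∏ i : Fin m, ((1 / Real.sqrt 2 : ℝ) : ℂ))]
  congr 1
  ext x y
  simp only [pureState, Matrix.vecMulVec_apply, Matrix.of_apply, Pi.star_apply,
    Finset.prod_const, Finset.card_univ, Fintype.card_fin]
  rw [Complex.star_def, map_pow, Complex.conj_ofReal, ← mul_pow, ← Complex.ofReal_mul]
  have : (1 / Real.sqrt 2) * (1 / Real.sqrt 2) = 2⁻¹ := by
    rw [div_mul_div_comm, Real.mul_self_sqrt (by norm_num)]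
    norm_num
  rw [this]
  simp

theorem exp_neg_le {u : ℝ} (h0 : 0 ≤ u) (h1 : u ≤ 1) : Real.exp (-u) ≤ 1 - u / 2 := by
  rw [Real.exp_neg, inv_le_comm₀ (Real.exp_pos _) (by linarith)]
  refine le_trans ?_ (Real.add_one_le_exp u)
  rw [inv_le_iff_one_le_mul₀ (by linarith)]
  nlinarith

/-- Only the small weight `q` contributes the gain: `q ^ s = exp (-s log (1/q))` is at most `1 - s
log (1/q) / 2` by `exp_neg_le`, which needs the exponent bounded by `1`. This linearization causes
the loss of a factor `2` in the rate. -/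
theorem rpow_add_rpow_le {q s : ℝ} (hq : 0 < q) (hq1 : q < 1) (hs : 0 < s)
    (hsq : s * -Real.log q ≤ 1) :
    (1 - q) ^ (1 + s) + q ^ (1 + s) ≤ Real.exp (-(s / 2 * (q * -Real.log q))) := by
  have h1 : (1 - q) ^ (1 + s) ≤ 1 - q := by
    have := Real.rpow_le_rpow_of_exponent_ge (x := 1 - q) (y := 1 + s) (z := 1) (by linarith)
      (by linarith) (by linarith)
    simpa using this
  have hlog : 0 ≤ -Real.log q := by linarith [Real.log_neg hq hq1]
  have h2 : q ^ s ≤ 1 - s * -Real.log q / 2 := by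
    rw [Real.rpow_def_of_pos hq]
    have := exp_neg_le (mul_nonneg hs.le hlog) hsq
    convert this using 2
    ring
  have h3 : q ^ (1 + s) ≤ q * (1 - s * -Real.log q / 2) := by
    rw [Real.rpow_add hq, Real.rpow_one]
    exact mul_le_mul_of_nonneg_left h2 hq.le
  have h4 := Real.add_one_le_exp (-(s / 2 * (q * -Real.log q)))
  linarith

theorem sum_schmidtWeight_rpow_le (hp : ∀ i, 0 < p i ∧ p i < 1) (n : ℕ) {s : ℝ} (hs : 0 < s)
    (hsp : ∀ i < n, s * -Real.log (p i) ≤ 1) :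
    ∑ x, schmidtWeight p n x ^ (1 + s) ≤
      Real.exp (-(s / 2 * ∑ i ∈ Finset.range n, p i * -Real.log (p i))) := by
  rw [sum_schmidtWeight_comp (p := p) (fun y => y ^ (1 + s))
    (fun m f hf => (Real.finsetProd_rpow _ _ (fun i _ => hf i) _).symm)
    (fun i => ⟨(hp i).1.le, (hp i).2.le⟩) n, Finset.mul_sum, ← Finset.sum_neg_distrib,
    Real.exp_sum, ← Fin.prod_univ_eq_prod_range
      (fun i => Real.exp (-(s / 2 * (p i * -Real.log (p i)))))]
  refine Finset.prod_le_prod (fun i _ => ?_) fun i _ =>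
    rpow_add_rpow_le (hp i).1 (hp i).2 hs (hsp i i.2)
  exact add_nonneg (Real.rpow_nonneg (by linarith [(hp i).2]) _) (Real.rpow_nonneg (hp i).1.le _)

end weights

/-! ### Types, error estimate and catalytic extraction of singlets. -/

/-- The type of a sequence of basis states: the number of nonzero entries in every column. -/
def columnCount {n N : ℕ} (y : Fin N → Fin n → Fin 2) (i : Fin n) : Fin (N + 1) :=
  ⟨(Finset.univ.filter fun j => ¬ y j i = 0).card, Nat.lt_succ_of_le
    ((Finset.card_le_univ _).trans_eq (Fintype.card_fin N))⟩

/-- The weight of the sequences of type `τ`. -/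
def typeWeight (p : ℕ → ℝ) (n N : ℕ) (τ : Fin n → Fin (N + 1)) : ℝ :=
  ∏ i : Fin n, ((1 - p i) ^ (N - τ i : ℕ) * p i ^ (τ i : ℕ))

theorem typeWeight_columnCount (p : ℕ → ℝ) {n N : ℕ} (y : Fin N → Fin n → Fin 2) :
    typeWeight p n N (columnCount y) = ∏ j, schmidtWeight p n (y j) := by
  simp only [typeWeight, schmidtWeight, columnCount]
  rw [Finset.prod_comm]
  refine Finset.prod_congr rfl fun i _ => ?_
  rw [Finset.prod_ite, Finset.prod_const, Finset.prod_const]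
  congr 2
  have := Finset.card_filter_add_card_filter_not (s := (Finset.univ : Finset (Fin N)))
    (fun j => y j i = 0)
  rw [Finset.card_univ, Fintype.card_fin] at this
  omega

/-- For `M + 1` copies and threshold `exp (-c) ^ (M + 1)`, the first term is polynomially many types
times `(2 ^ m exp (-c)) ^ (M + 1)`, and the second is `exp (-s (S/2 - c)) ^ (M + 1)`. Both tend to
zero exactly because `m log 2 < c < S/2`. -/
theorem exists_small_error {n m : ℕ} {S s c : ℝ} (hs : 0 < s) (hc1 : m * Real.log 2 < c)
    (hc2 : c < S / 2) {δ : ℝ} (hδ : 0 < δ) :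
    ∃ M : ℕ, ((M + 1 + 1 : ℕ) : ℝ) ^ n * (((2 ^ m) ^ (M + 1) : ℕ) * Real.exp (-c) ^ (M + 1)) +
      (Real.exp (-c) ^ (M + 1)) ^ (-s) * Real.exp (-(s / 2 * S)) ^ (M + 1) < δ := by
  set a : ℝ := 2 ^ m * Real.exp (-c) with ha
  have ha0 : 0 < a := by positivity
  have ha1 : a < 1 := by
    have : (2 : ℝ) ^ m = Real.exp (m * Real.log 2) := by
      rw [Real.exp_nat_mul, Real.exp_log (by norm_num)]
    rw [ha, this, ← Real.exp_add, Real.exp_lt_one_iff]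
    linarith
  set b : ℝ := Real.exp (-(s * (S / 2 - c))) with hb
  have hb1 : b < 1 := by
    rw [hb, Real.exp_lt_one_iff]
    have := mul_pos hs (sub_pos.2 hc2)
    linarith
  have t1 := (tendsto_pow_const_mul_const_pow_of_abs_lt_one n
    (by rwa [abs_of_pos ha0] : |a| < 1)).comp (Filter.tendsto_add_atTop_nat 2)
  have t2 := (tendsto_pow_atTop_nhds_zero_of_lt_one (Real.exp_pos _).le hb1).comp
    (Filter.tendsto_add_atTop_nat 1)
  -- The polynomial factor is `(M + 2) ^ n` but the power is `a ^ (M + 1)`; shifting both by two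
  -- costs one factor of `a`, removed here.
  have t3 := (t1.const_mul a⁻¹).add t2
  simp only [mul_zero, add_zero] at t3
  obtain ⟨M, hM⟩ := (t3.eventually (gt_mem_nhds hδ)).exists
  refine ⟨M, ?_⟩
  refine lt_of_eq_of_lt ?_ hM
  refine congrArg₂ (fun x y : ℝ => x + y) ?_ ?_
  · simp only [Function.comp_def]
    rw [pow_succ a (M + 1), ha]
    push_cast
    field_simp
    ring
  · simp only [Function.comp_def]
    rw [← Real.exp_nat_mul, ← Real.exp_nat_mul, ← Real.exp_mul, ← Real.exp_add,
      ← Real.exp_nat_mul]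
    congr 1
    ring

/-- Catalytic extraction of `m` singlets from a product of two-qubit pure states. -/
theorem catalyticallyConvertible_of_lt {p : ℕ → ℝ} (hp : ∀ i, 0 < p i ∧ p i < 1) {m n : ℕ}
    (hmn : m ≤ n)
    (hS : 2 * (m * Real.log 2) < ∑ i ∈ Finset.range n, p i * -Real.log (p i)) :
    CatalyticallyConvertible (pureState (productState (fun i => twoQubitState (p i)) n))
      (pureState (productState (fun _ => singlet) m)) := by
  classical
  intro δ hδ
  set S := ∑ i ∈ Finset.range n, p i * -Real.log (p i)
  have hlog : ∀ i, 0 ≤ -Real.log (p i) := fun i => by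
    linarith [Real.log_neg (hp i).1 (hp i).2]
  obtain ⟨s, hs, hsp⟩ : ∃ s : ℝ, 0 < s ∧ ∀ i < n, s * -Real.log (p i) ≤ 1 := by
    have h0 : 0 < 1 + ∑ i ∈ Finset.range n, -Real.log (p i) := by
      have := Finset.sum_nonneg (s := Finset.range n) fun i _ => hlog i
      linarith
    refine ⟨(1 + ∑ i ∈ Finset.range n, -Real.log (p i))⁻¹, inv_pos.2 h0, fun i hi => ?_⟩
    rw [inv_mul_le_one₀ h0]
    have := Finset.single_le_sum (f := fun i => -Real.log (p i)) (fun i _ => hlog i)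
      (Finset.mem_range.2 hi)
    linarith
  obtain ⟨c, hc1, hc2⟩ : ∃ c, m * Real.log 2 < c ∧ c < S / 2 := exists_between (by linarith)
  -- The error is halved since `B` enters the trace-norm bound twice, through `P` and `Q`.
  obtain ⟨M, hM⟩ := exists_small_error (n := n) hs hc1 hc2 (half_pos hδ)
  let X := Fin n → Fin 2
  let A := Fin m → Fin 2
  obtain ⟨e⟩ : Nonempty (A ↪ X) := Function.Embedding.nonempty_of_card_le (by
    simp only [X, A, Fintype.card_fun, Fintype.card_fin]
    exact Nat.pow_le_pow_right (by norm_num) hmn)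
  set v : X → ℂ := fun x => ((Real.sqrt (schmidtWeight p n x) : ℝ) : ℂ) with hv
  have hw := fun x => (schmidtWeight_pos hp n x).le
  set r := pureState v with hr
  have hr1 : r.trace = 1 := by
    simp only [Matrix.trace, Matrix.diag_apply, hr, pureState, Matrix.vecMulVec_apply,
      Pi.star_apply, hv, Complex.star_def, Complex.conj_ofReal, ← Complex.ofReal_mul,
      ← Complex.ofReal_sum, Real.mul_self_sqrt (hw _)]
    exact congrArg Complex.ofReal (sum_schmidtWeight hp n)
  let D := Fin (M + 1) → A
  let ι : D ↪ (Fin (M + 1) → X) :=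
    ⟨fun z j => e (z j), fun z z' h => funext fun j => e.injective (congrFun h j)⟩
  have hcardA : Fintype.card A = 2 ^ m := by simp [A]
  have hcardD : Fintype.card D = (2 ^ m) ^ (M + 1) := by simp [D, A]
  have htw : ∀ τ, 0 ≤ typeWeight p n (M + 1) τ := fun τ => Finset.prod_nonneg fun i _ =>
    mul_nonneg (pow_nonneg (by linarith [(hp i).2]) _) (pow_nonneg (hp i).1.le _)
  have hsum : ∑ y : Fin (M + 1) → X, typeWeight p n (M + 1) (columnCount y) = 1 := by
    simp only [typeWeight_columnCount]
    rw [← Fintype.prod_sum (fun (_ : Fin (M + 1)) x => schmidtWeight p n x)]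
    simp [sum_schmidtWeight hp n]
  obtain ⟨I, _, _, γ, B, c', hγ, hB, hconc, hBtr⟩ :=
    exists_concentration (columnCount (n := n) (N := M + 1)) (typeWeight p n (M + 1)) htw hsum ι
  have hBlt : B.trace.re < δ / 2 := by
    rw [hBtr]
    refine lt_of_le_of_lt (sum_mod_card_le _ _ htw Fintype.card_pos
      (pow_pos (Real.exp_pos (-c)) (M + 1)) hs) (lt_of_le_of_lt ?_ hM)
    rw [hcardD]
    refine add_le_add (le_of_eq ?_) (mul_le_mul_of_nonneg_left ?_ ?_)
    · simp
    · simp only [typeWeight_columnCount]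
      have : ∀ y : Fin (M + 1) → X, (∏ j, schmidtWeight p n (y j)) ^ (1 + s) =
          ∏ j, schmidtWeight p n (y j) ^ (1 + s) := fun y =>
        (Real.finsetProd_rpow _ _ (fun j _ => hw (y j)) _).symm
      simp only [this]
      rw [← Fintype.prod_sum (fun (_ : Fin (M + 1)) x => schmidtWeight p n x ^ (1 + s)),
        Finset.prod_const, Finset.card_univ, Fintype.card_fin]
      exact pow_le_pow_left₀ (Finset.sum_nonneg fun x _ => Real.rpow_nonneg (hw x) _)
        (sum_schmidtWeight_rpow_le hp n hs hsp) _
    · positivity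
  -- The chain needs input and output copies of the same type, so the `m` singlets are first
  -- produced inside the `n`-qubit label space via `e`; `f` extracts them afterwards.
  set σ : Matrix X X ℂ := Matrix.of fun x y => if x ∈ Set.range e ∧ y ∈ Set.range e
    then ((Fintype.card A : ℂ))⁻¹ else 0 with hσ
  have hσ0 : ∀ x y, ¬ (x ∈ Set.range e ∧ y ∈ Set.range e) → σ x y = 0 := fun x y h => if_neg h
  have hσp : σ.PosSemidef := by
    have : σ = ((Fintype.card A : ℂ))⁻¹ • pureState fun x => if x ∈ Set.range e then 1 else 0 := by
      ext x y
      simp only [hσ, pureState, Matrix.of_apply, Matrix.smul_apply, Matrix.vecMulVec_apply,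
        Pi.star_apply]
      by_cases hx : x ∈ Set.range e <;> by_cases hy : y ∈ Set.range e <;> simp [hx, hy]
    rw [this]
    refine (Matrix.posSemidef_vecMulVec_self_star _).smul ?_
    exact inv_nonneg.2 (Nat.cast_nonneg _)
  have hA0 : (Fintype.card A : ℂ) ≠ 0 := by exact_mod_cast Fintype.card_ne_zero
  have hσ1 : σ.trace = 1 := by
    simp only [Matrix.trace, Matrix.diag_apply, hσ, Matrix.of_apply, and_self]
    rw [← Finset.sum_filter, Finset.sum_const]
    have : (Finset.univ.filter fun x => x ∈ Set.range e) = Finset.univ.map e := by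
      ext x
      simp
    rw [this, Finset.card_map, Finset.card_univ, nsmul_eq_mul, mul_inv_cancel₀ hA0]
  -- Labels outside `range e` carry no weight in `σ`; recording them in the outcome merely makes `f`
  -- injective.
  let f : X → Option X × A := fun x =>
    if h : ∃ a, e a = x then (none, h.choose) else (some x, fun _ => 0)
  have hfe : ∀ a, f (e a) = (none, a) := by
    intro a
    have h : ∃ a', e a' = e a := ⟨a, rfl⟩
    simp only [f, dif_pos h, Prod.mk.injEq, true_and]
    exact e.injective h.choose_spec
  have hfn : ∀ x, x ∉ Set.range e → f x = (some x, fun _ => 0) := by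
    intro x hx
    have h : ¬ ∃ a, e a = x := hx
    simp only [f, dif_neg h]
  have hf : Function.Injective f := by
    intro x y h
    by_cases hx : x ∈ Set.range e <;> by_cases hy : y ∈ Set.range e
    · obtain ⟨a, rfl⟩ := hx
      obtain ⟨b, rfl⟩ := hy
      rw [hfe, hfe] at h
      rw [(Prod.mk.inj h).2]
    · obtain ⟨a, rfl⟩ := hx
      rw [hfe, hfn y hy] at h
      simp at h
    · obtain ⟨b, rfl⟩ := hy
      rw [hfe, hfn x hx] at h
      simp at h
    · rw [hfn x hx, hfn y hy] at h
      simpa using h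
  have hfσ : labelChannel f σ = Matrix.of fun _ _ : A => ((2 : ℂ) ^ m)⁻¹ := by
    ext a b
    rw [labelChannel_apply, Finset.sum_eq_single (e a), Finset.sum_eq_single (e b)]
    · simp [hfe, hσ, hcardA]
    · intro y _ hy
      by_cases hyr : y ∈ Set.range e
      · obtain ⟨b', rfl⟩ := hyr
        have : b' ≠ b := fun h => hy (by rw [h])
        simp [hfe, this]
      · rw [hσ0 _ _ fun h => hyr h.2, ite_self]
    · simp
    · intro x _ hx
      refine Finset.sum_eq_zero fun y _ => ?_
      by_cases hxr : x ∈ Set.range e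
      · obtain ⟨a', rfl⟩ := hxr
        have : a' ≠ a := fun h => hx (by rw [h])
        simp [hfe, this]
      · rw [hσ0 _ _ fun h => hxr h.1, ite_self]
    · simp
  have hin : (pureState fun y : Fin (M + 1) → X =>
      ((Real.sqrt (typeWeight p n (M + 1) (columnCount y)) : ℝ) : ℂ)) =
      tensorFamily fun _ => r := by
    ext x y
    simp only [pureState, tensorFamily, hr, hv, Matrix.vecMulVec_apply, Matrix.of_apply,
      Pi.star_apply, typeWeight_columnCount, Finset.prod_mul_distrib]
    rw [Real.sqrt_prod _ fun j _ => hw _, Real.sqrt_prod _ fun j _ => hw _]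
    simp
  have hout : (Matrix.of fun x y : Fin (M + 1) → X => if x ∈ Set.range ι ∧ y ∈ Set.range ι
      then ((Fintype.card D : ℂ))⁻¹ else 0) = tensorFamily fun _ => σ := by
    have hι : ∀ x, x ∈ Set.range ι ↔ ∀ j, x j ∈ Set.range e := by
      intro x
      constructor
      · rintro ⟨z, rfl⟩ j
        exact ⟨z j, rfl⟩
      · intro h
        choose z hz using h
        exact ⟨z, funext hz⟩
    ext x y
    simp only [tensorFamily, hσ, Matrix.of_apply]
    by_cases h : x ∈ Set.range ι ∧ y ∈ Set.range ι
    · rw [if_pos h, Finset.prod_congr rfl fun j _ => if_pos ⟨(hι x).1 h.1 j, (hι y).1 h.2 j⟩,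
        Finset.prod_const, hcardD, hcardA]
      simp
    · rw [if_neg h]
      have : ∃ j, ¬ (x j ∈ Set.range e ∧ y j ∈ Set.range e) := by
        by_contra hcon
        push Not at hcon
        exact h ⟨(hι x).2 fun j => (hcon j).1, (hι y).2 fun j => (hcon j).2⟩
      obtain ⟨j, hj⟩ := this
      rw [Finset.prod_eq_zero (Finset.mem_univ j) (if_neg hj)]
  rw [hin, hout] at hconc
  obtain ⟨C, L, _, _, _, _, T, F, hT, hF, hFT, P, Q, hP, hQ, hPt, hQt, hPQ⟩ :=
    exists_catalyst (r := r) (Matrix.posSemidef_vecMulVec_self_star v) hr1 hσp hσ1 hf hγ hB hconc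
  obtain ⟨Λ, hΛ, hΛmc⟩ := exists_isLOCC_maxCorrelated hF
  have hρ : pureState (productState (fun i => twoQubitState (p i)) n) = maxCorrelated r := by
    rw [productState_twoQubitState hp, pureState_diagonal v]
  refine ⟨C, C, inferInstance, inferInstance, inferInstance, inferInstance, maxCorrelated T, Λ,
    ⟨posSemidef_maxCorrelated hT.1, (trace_maxCorrelated T).trans hT.2⟩, hΛ, ?_, ?_⟩
  · rw [hρ, bipartiteTensor_maxCorrelated, hΛmc, pureState_productState_singlet, ← hfσ,
      bipartiteTensor_maxCorrelated, ← maxCorrelated_sub, hPQ, maxCorrelated_sub]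
    refine lt_of_le_of_lt (traceNorm_sub_le (posSemidef_maxCorrelated hP)
      (posSemidef_maxCorrelated hQ)) ?_
    rw [trace_maxCorrelated, trace_maxCorrelated, hPt, hQt]
    linarith
  · rw [hρ, bipartiteTensor_maxCorrelated, hΛmc, traceOutSystem_maxCorrelated, hFT]

/-! ### Upper bound on the success probability of probabilistic LOCC. -/

section probabilistic

open Matrix

theorem overlap_add {X : Type} [Fintype X] (φ : X → ℂ) (M N : Matrix X X ℂ) :
    overlap φ (M + N) = overlap φ M + overlap φ N := by
  simp [overlap, add_mulVec, dotProduct_add]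

theorem overlap_smul {X : Type} [Fintype X] (φ : X → ℂ) (c : ℝ) (M : Matrix X X ℂ) :
    overlap φ ((c : ℂ) • M) = c * overlap φ M := by
  simp [overlap, smul_mulVec, dotProduct_smul]

theorem overlap_nonneg {X : Type} [Fintype X] (φ : X → ℂ) {M : Matrix X X ℂ}
    (hM : M.PosSemidef) : 0 ≤ overlap φ M :=
  (Complex.le_def.1 (hM.dotProduct_mulVec_nonneg φ)).1

theorem overlap_singlet (M : Matrix (Fin 2 × Fin 2) (Fin 2 × Fin 2) ℂ) :
    overlap singlet M = (M (0, 0) (0, 0) + M (0, 0) (1, 1) + M (1, 1) (0, 0) +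
      M (1, 1) (1, 1)).re / 2 := by
  have h : ((Real.sqrt 2 : ℝ) : ℂ)⁻¹ * ((Real.sqrt 2 : ℝ) : ℂ)⁻¹ = 2⁻¹ := by
    rw [← mul_inv, ← Complex.ofReal_mul, Real.mul_self_sqrt (by norm_num)]
    norm_num
  have : star singlet ⬝ᵥ M *ᵥ singlet = (M (0, 0) (0, 0) + M (0, 0) (1, 1) + M (1, 1) (0, 0) +
      M (1, 1) (1, 1)) * (((Real.sqrt 2 : ℝ) : ℂ)⁻¹ * ((Real.sqrt 2 : ℝ) : ℂ)⁻¹) := by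
    simp [dotProduct, mulVec, singlet, Fintype.sum_prod_type, Fin.sum_univ_two]
    ring
  rw [overlap, this, h, ← div_eq_mul_inv]
  simp

/-- The trace minus the overlap is the overlap with `(|00⟩ - |11⟩) / √2` plus the diagonal entries
at `01` and `10`, all nonnegative. -/
theorem overlap_singlet_le_trace {M : Matrix (Fin 2 × Fin 2) (Fin 2 × Fin 2) ℂ}
    (hM : M.PosSemidef) : overlap singlet M ≤ M.trace.re := by
  have h1 := overlap_nonneg (fun x => if x = (0, 0) then 1 else if x = (1, 1) then -1 else 0) hM
  have h2 := (Complex.le_def.1 (hM.diag_nonneg (i := (0, 1)))).1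
  have h3 := (Complex.le_def.1 (hM.diag_nonneg (i := (1, 0)))).1
  rw [overlap_singlet]
  simp [overlap, dotProduct, mulVec, Fintype.sum_prod_type, Fin.sum_univ_two] at h1
  simp [Matrix.trace, Fintype.sum_prod_type, Fin.sum_univ_two] at h2 h3 ⊢
  linarith

/-- The unnormalized product vector of `x` and `y`. -/
def productVector {A B : Type} (x : A → ℂ) (y : B → ℂ) : A × B → ℂ := fun q => x q.1 * y q.2

/-- This is the Cauchy–Schwarz inequality `|x₀y₀ + x₁y₁|² ≤ ‖x‖²‖y‖²`; the two squares are the real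
and imaginary parts in Lagrange's identity. -/
theorem overlap_singlet_productVector (x y : Fin 2 → ℂ) :
    overlap singlet (pureState (productVector x y)) ≤
      (pureState (productVector x y)).trace.re / 2 := by
  rw [overlap_singlet]
  simp only [pureState, productVector, vecMulVec_apply, Matrix.trace, Fintype.sum_prod_type,
    Fin.sum_univ_two, diag_apply, Pi.star_apply, Complex.add_re, Complex.mul_re, Complex.mul_im,
    Complex.star_def, Complex.conj_re, Complex.conj_im, map_mul]
  have h1 := sq_nonneg ((x 0).re * (y 1).re + (x 0).im * (y 1).im - (x 1).re * (y 0).re -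
    (x 1).im * (y 0).im)
  have h2 := sq_nonneg ((x 0).im * (y 1).re - (x 0).re * (y 1).im - (x 1).im * (y 0).re +
    (x 1).re * (y 0).im)
  linarith

/-- What probabilistic LOCC protocols with a two-qubit output do. -/
structure IsEntanglementMonotone {A B : Type} [Fintype A] [Fintype B]
    (Λ : Matrix (A × B) (A × B) ℂ → Matrix (Fin 2 × Fin 2) (Fin 2 × Fin 2) ℂ) : Prop where
  add : ∀ M N, Λ (M + N) = Λ M + Λ N
  smul : ∀ (c : ℂ) M, Λ (c • M) = c • Λ M
  posSemidef : ∀ M, M.PosSemidef → (Λ M).PosSemidef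
  trace_le : ∀ M, M.PosSemidef → (Λ M).trace.re ≤ M.trace.re
  overlap_le : ∀ x y, overlap singlet (Λ (pureState (productVector x y))) ≤
    (Λ (pureState (productVector x y))).trace.re / 2

theorem kronecker_one_mulVec_productVector {A A₁ B : Type} [Fintype A] [Fintype B]
    [DecidableEq B] (K : Matrix A₁ A ℂ) (x : A → ℂ) (y : B → ℂ) :
    (K ⊗ₖ (1 : Matrix B B ℂ)) *ᵥ productVector x y = productVector (K *ᵥ x) y := by
  ext ⟨a, b⟩
  simp only [mulVec, dotProduct, Fintype.sum_prod_type, kroneckerMap_apply, productVector,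
    one_apply, Finset.sum_mul]
  refine Finset.sum_congr rfl fun a' _ => ?_
  rw [Finset.sum_eq_single b]
  · simp [mul_assoc]
  · intro b' _ hb
    simp [Ne.symm hb]
  · simp

theorem one_kronecker_mulVec_productVector {A B B₁ : Type} [Fintype A] [Fintype B]
    [DecidableEq A] (K : Matrix B₁ B ℂ) (x : A → ℂ) (y : B → ℂ) :
    ((1 : Matrix A A ℂ) ⊗ₖ K) *ᵥ productVector x y = productVector x (K *ᵥ y) := by
  ext ⟨a, b⟩
  simp only [mulVec, dotProduct, Fintype.sum_prod_type, kroneckerMap_apply, productVector,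
    one_apply, Finset.mul_sum]
  rw [Finset.sum_eq_single a]
  · refine Finset.sum_congr rfl fun b' _ => ?_
    simp
    ring
  · intro a' _ ha
    simp [Ne.symm ha]
  · simp

theorem mul_pureState_mul {X Y : Type} [Fintype X] (L : Matrix Y X ℂ) (v : X → ℂ) :
    L * pureState v * Lᴴ = pureState (L *ᵥ v) := by
  rw [pureState, pureState, mul_vecMulVec, vecMulVec_mul, star_mulVec]

theorem overlap_sum {X ι : Type} [Fintype X] (φ : X → ℂ) (s : Finset ι)
    (M : ι → Matrix X X ℂ) : overlap φ (∑ i ∈ s, M i) = ∑ i ∈ s, overlap φ (M i) := by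
  classical
  induction s using Finset.induction_on with
  | empty => simp [overlap]
  | insert i s hi ih => rw [Finset.sum_insert hi, Finset.sum_insert hi, overlap_add, ih]

/-- Common induction step for both parties: what matters about a local Kraus operator is that it
maps product vectors to product vectors. -/
theorem isEntanglementMonotone_sum {A B A₁ B₁ : Type} [Fintype A] [Fintype B] [Fintype A₁]
    [Fintype B₁] [DecidableEq A] [DecidableEq B] {r : ℕ}
    (L : Fin r → Matrix (A₁ × B₁) (A × B) ℂ) (hL : ∑ i, (L i)ᴴ * L i = 1)
    (hprod : ∀ i x y, ∃ x' y', L i *ᵥ productVector x y = productVector x' y')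
    {Λ : Fin r → Matrix (A₁ × B₁) (A₁ × B₁) ℂ → Matrix (Fin 2 × Fin 2) (Fin 2 × Fin 2) ℂ}
    (hΛ : ∀ i, IsEntanglementMonotone (Λ i)) :
    IsEntanglementMonotone fun ρ : Matrix (A × B) (A × B) ℂ => ∑ i, Λ i (L i * ρ * (L i)ᴴ) where
  add M N := by
    simp only [Matrix.mul_add, Matrix.add_mul, (hΛ _).add, Finset.sum_add_distrib]
  smul c M := by
    simp only [Matrix.mul_smul, Matrix.smul_mul, (hΛ _).smul, Finset.smul_sum]
  posSemidef M hM := posSemidef_sum _ fun i _ =>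
    (hΛ i).posSemidef _ (hM.mul_mul_conjTranspose_same _)
  trace_le M hM := by
    have h : M.trace = ∑ i, (L i * M * (L i)ᴴ).trace := by
      simp_rw [Matrix.mul_assoc, trace_mul_comm (L _), Matrix.mul_assoc]
      rw [← trace_sum, ← Matrix.mul_sum, hL, mul_one]
    rw [h, trace_sum, Complex.re_sum, Complex.re_sum]
    exact Finset.sum_le_sum fun i _ => (hΛ i).trace_le _ (hM.mul_mul_conjTranspose_same _)
  overlap_le x y := by
    rw [overlap_sum, trace_sum, Complex.re_sum, Finset.sum_div]
    refine Finset.sum_le_sum fun i _ => ?_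
    obtain ⟨x', y', h⟩ := hprod i x y
    rw [mul_pureState_mul, h]
    exact (hΛ i).overlap_le x' y'

theorem isEntanglementMonotone_of_protocolMap {A B : Type} {canAbort : Prop}
    {Λ : Matrix (A × B) (A × B) ℂ → Matrix (Fin 2 × Fin 2) (Fin 2 × Fin 2) ℂ}
    (h : ProtocolMap canAbort Λ) [iA : Fintype A] [iB : Fintype B] :
    IsEntanglementMonotone Λ := by
  -- The `Fintype` instances must vary in the induction, since the local types change along the
  -- protocol and each measurement carries its own instances.
  revert iA iB
  induction h with
  | done =>
    intro iA iB
    obtain rfl := Subsingleton.elim iA (Fin.fintype 2)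
    obtain rfl := Subsingleton.elim iB (Fin.fintype 2)
    exact ⟨fun _ _ => rfl, fun _ _ => rfl, fun _ h => h, fun _ _ => le_rfl,
      overlap_singlet_productVector⟩
  | abort =>
    intro iA iB
    refine ⟨fun _ _ => (add_zero _).symm, fun _ _ => (smul_zero _).symm,
      fun _ _ => PosSemidef.zero, fun M hM => ?_, fun _ _ => by simp [overlap]⟩
    simpa using (Complex.le_def.1 hM.trace_nonneg).1
  | @alice A B A₁ jA _ _ jB _ r K hK Λ hΛ ih =>
    intro iA iB
    obtain rfl := Subsingleton.elim iA jA
    obtain rfl := Subsingleton.elim iB jB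
    refine isEntanglementMonotone_sum (fun i => K i ⊗ₖ (1 : Matrix B B ℂ)) ?_
      (fun i x y => ⟨_, _, kronecker_one_mulVec_productVector _ _ _⟩) fun i => ih i
    simp only [conjTranspose_kronecker, ← mul_kronecker_mul, conjTranspose_one, mul_one]
    have : ∑ i, ((K i)ᴴ * K i) ⊗ₖ (1 : Matrix B B ℂ) =
        (∑ i, (K i)ᴴ * K i) ⊗ₖ (1 : Matrix B B ℂ) := by
      ext p q
      simp [Matrix.sum_apply, Finset.sum_mul]
    rw [this, hK, one_kronecker_one]
  | @bob A B B₁ jB _ _ jA _ r K hK Λ hΛ ih =>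
    intro iA iB
    obtain rfl := Subsingleton.elim iA jA
    obtain rfl := Subsingleton.elim iB jB
    refine isEntanglementMonotone_sum (fun i => (1 : Matrix A A ℂ) ⊗ₖ K i) ?_
      (fun i x y => ⟨_, _, one_kronecker_mulVec_productVector _ _ _⟩) fun i => ih i
    simp only [conjTranspose_kronecker, ← mul_kronecker_mul, conjTranspose_one, mul_one]
    have : ∑ i, (1 : Matrix A A ℂ) ⊗ₖ ((K i)ᴴ * K i) =
        (1 : Matrix A A ℂ) ⊗ₖ (∑ i, (K i)ᴴ * K i) := by
      ext p q
      simp [Matrix.sum_apply, Finset.mul_sum]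
    rw [this, hK, one_kronecker_one]

theorem posSemidef_pureState {X : Type} [Fintype X] (v : X → ℂ) : (pureState v).PosSemidef :=
  posSemidef_vecMulVec_self_star v

/-- A weighted parallelogram identity in which the cross terms cancel. Dropping the second,
positive, term bounds `|u + w⟩⟨u + w|` by a combination with coefficient close to `1` on `u` when
`k` is small. -/
theorem pureState_add_add {X : Type} (u w : X → ℂ) {k : ℝ} (hk : k ≠ 0) :
    pureState (u + w) + pureState ((k : ℂ) • u - ((k⁻¹ : ℝ) : ℂ) • w) =
      ((1 + k ^ 2 : ℝ) : ℂ) • pureState u + ((1 + (k ^ 2)⁻¹ : ℝ) : ℂ) • pureState w := by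
  have hk' : (k : ℂ) ≠ 0 := by exact_mod_cast hk
  ext a b
  simp only [pureState, Matrix.add_apply, vecMulVec_apply, Pi.add_apply, Pi.star_apply,
    Pi.sub_apply, Pi.smul_apply, smul_eq_mul, star_add, star_sub, star_mul', Matrix.smul_apply,
    Complex.star_def, Complex.conj_ofReal]
  push_cast
  field_simp
  ring

section bounds

variable {A B : Type} [Fintype A] [Fintype B]
  {Λ : Matrix (A × B) (A × B) ℂ → Matrix (Fin 2 × Fin 2) (Fin 2 × Fin 2) ℂ}

theorem IsEntanglementMonotone.overlap_add_le (hΛ : IsEntanglementMonotone Λ)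
    (u w : A × B → ℂ) {k : ℝ} (hk : k ≠ 0) :
    overlap singlet (Λ (pureState (u + w))) ≤
      (1 + k ^ 2) * overlap singlet (Λ (pureState u)) +
        (1 + (k ^ 2)⁻¹) * overlap singlet (Λ (pureState w)) := by
  have h := congrArg (fun M => overlap singlet (Λ M)) (pureState_add_add u w hk)
  simp only [hΛ.add, hΛ.smul, overlap_add, overlap_smul] at h
  have := overlap_nonneg singlet (hΛ.posSemidef _
    (posSemidef_pureState ((k : ℂ) • u - ((k⁻¹ : ℝ) : ℂ) • w)))
  linarith

theorem IsEntanglementMonotone.trace_add_le (hΛ : IsEntanglementMonotone Λ)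
    (u w : A × B → ℂ) {k : ℝ} (hk : k ≠ 0) :
    (Λ (pureState (u + w))).trace.re ≤ (1 + k ^ 2) * (Λ (pureState u)).trace.re +
        (1 + (k ^ 2)⁻¹) * (Λ (pureState w)).trace.re := by
  have h := congrArg (fun M => (Λ M).trace.re) (pureState_add_add u w hk)
  simp only [hΛ.add, hΛ.smul, trace_add, trace_smul, Complex.add_re, smul_eq_mul,
    Complex.re_ofReal_mul] at h
  have := (Complex.le_def.1 (hΛ.posSemidef _
    (posSemidef_pureState ((k : ℂ) • u - ((k⁻¹ : ℝ) : ℂ) • w))).trace_nonneg).1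
  rw [Complex.zero_re] at this
  linarith

/-- A state close to a product state yields a good singlet only with small probability. -/
theorem exists_trace_le {f : ℝ} (hf : 1 / 2 < f) :
    ∃ K : ℝ, 0 < K ∧ ∀ {A B : Type} [Fintype A] [Fintype B]
      {Λ : Matrix (A × B) (A × B) ℂ → Matrix (Fin 2 × Fin 2) (Fin 2 × Fin 2) ℂ},
      IsEntanglementMonotone Λ → ∀ (x : A → ℂ) (y : B → ℂ) (w : A × B → ℂ),
      f * (Λ (pureState (productVector x y + w))).trace.re ≤
        overlap singlet (Λ (pureState (productVector x y + w))) →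
      (Λ (pureState (productVector x y + w))).trace.re ≤ K * (pureState w).trace.re := by
  set g := f - 1 / 2 with hg
  have hg0 : 0 < g := by linarith
  -- Chosen so that `(1 + t)² / 2 ≤ 1/2 + 3t/2 ≤ f - g/2`, leaving a margin `g/2` below `f`.
  set t := min 1 (g / 3) with ht
  have ht0 : 0 < t := lt_min one_pos (by linarith)
  have ht1 : t ≤ 1 := min_le_left _ _
  have ht2 : t ≤ g / 3 := min_le_right _ _
  set k := Real.sqrt t with hk
  have hk0 : k ≠ 0 := (Real.sqrt_pos.2 ht0).ne'
  have hk2 : k ^ 2 = t := Real.sq_sqrt ht0.le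
  have hti : 0 < t⁻¹ := inv_pos.2 ht0
  set C := (1 + t) / 2 * (1 + t⁻¹) + (1 + t⁻¹) with hC
  have hC0 : 0 < C := by positivity
  refine ⟨2 * C / g, by positivity, ?_⟩
  intro A B _ _ Λ hΛ x y w h
  set u := productVector x y
  set p := (Λ (pureState (u + w))).trace.re
  set η := (pureState w).trace.re
  have hw := posSemidef_pureState w
  have h1 := hΛ.overlap_add_le u w hk0
  -- Writing `u = (u + w) + (-w)` bounds the trace for the product part back in terms of the success
  -- probability `p`.
  have h2 := hΛ.trace_add_le (u + w) (-w) hk0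
  have hneg : pureState (-w) = pureState w := by
    ext a b
    simp [pureState, vecMulVec_apply]
  rw [add_neg_cancel_right, hneg] at h2
  rw [hk2] at h1 h2
  have h3 := hΛ.overlap_le x y
  have h4 := overlap_singlet_le_trace (hΛ.posSemidef _ hw)
  have h5 := hΛ.trace_le _ hw
  have h6 : overlap singlet (Λ (pureState (u + w))) ≤ (1 + t) ^ 2 / 2 * p + C * η := by
    have a1 : (1 + t⁻¹) * overlap singlet (Λ (pureState w)) ≤ (1 + t⁻¹) * η :=
      mul_le_mul_of_nonneg_left (h4.trans h5) (by positivity)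
    have a2 : (1 + t⁻¹) * (Λ (pureState w)).trace.re ≤ (1 + t⁻¹) * η :=
      mul_le_mul_of_nonneg_left h5 (by positivity)
    have a3 : (1 + t) * overlap singlet (Λ (pureState u)) ≤
        (1 + t) * (((1 + t) * p + (1 + t⁻¹) * η) / 2) :=
      mul_le_mul_of_nonneg_left (by linarith) (by positivity)
    rw [hC]
    linarith
  have hp0 : 0 ≤ p := by
    have := (Complex.le_def.1 (hΛ.posSemidef _ (posSemidef_pureState (u + w))).trace_nonneg).1
    simpa using this
  have h7 : (1 + t) ^ 2 / 2 ≤ f - g / 2 := by nlinarith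
  have h8 : (1 + t) ^ 2 / 2 * p ≤ (f - g / 2) * p := mul_le_mul_of_nonneg_right h7 hp0
  rw [div_mul_eq_mul_div, le_div_iff₀ hg0]
  linarith

end bounds

end probabilistic

/-! ### Closeness of the state to a product vector. -/

theorem one_sub_sum_le_prod {p : ℕ → ℝ} (hp : ∀ i, 0 < p i ∧ p i < 1) (n : ℕ) :
    1 - ∑ i ∈ Finset.range n, p i ≤ ∏ i ∈ Finset.range n, (1 - p i) := by
  induction n with
  | zero => simp
  | succ n ih =>
    rw [Finset.sum_range_succ, Finset.prod_range_succ]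
    have h1 : ∏ i ∈ Finset.range n, (1 - p i) ≤ 1 :=
      Finset.prod_le_one (fun i _ => by linarith [(hp i).2]) fun i _ => by linarith [(hp i).1]
    have h2 := mul_le_mul_of_nonneg_right h1 (hp n).1.le
    linarith

theorem exists_productState_eq_add {p : ℕ → ℝ} (hp : ∀ i, 0 < p i ∧ p i < 1) (n : ℕ) :
    ∃ x y w, productState (fun i => twoQubitState (p i)) n = productVector x y + w ∧
      (pureState w).trace.re ≤ ∑ i ∈ Finset.range n, p i := by
  set v : (Fin n → Fin 2) → ℂ := fun x => ((Real.sqrt (schmidtWeight p n x) : ℝ) : ℂ) with hv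
  -- The product vector is the whole `|0…0⟩|0…0⟩` component with its amplitude; thus `‖w‖² = 1 - ∏
  -- (1 - p i)`.
  refine ⟨fun x => if x = 0 then v x else 0, fun y => if y = 0 then 1 else 0,
    fun q => if q.1 = q.2 then (if q.1 = 0 then 0 else v q.1) else 0, ?_, ?_⟩
  · rw [productState_twoQubitState hp]
    ext ⟨a, b⟩
    simp only [productVector, Pi.add_apply]
    by_cases hab : a = b
    · subst hab
      by_cases ha : a = 0 <;> simp [ha, hv]
    · by_cases ha : a = 0
      · subst ha
        simp [hab, Ne.symm hab]
      · simp [hab, ha]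
  · have h1 : (pureState fun q : (Fin n → Fin 2) × (Fin n → Fin 2) =>
        if q.1 = q.2 then (if q.1 = 0 then 0 else v q.1) else 0) =
        maxCorrelated (pureState fun x => if x = 0 then 0 else v x) :=
      pureState_diagonal (fun x => if x = 0 then 0 else v x)
    have h2 : ((pureState fun x => if x = 0 then 0 else v x).trace).re =
        ∑ x, if x = 0 then 0 else schmidtWeight p n x := by
      rw [Matrix.trace, Complex.re_sum]
      refine Finset.sum_congr rfl fun x _ => ?_
      simp only [pureState, Matrix.diag_apply, Matrix.vecMulVec_apply, Pi.star_apply]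
      split_ifs
      · simp
      · simp only [hv, Complex.star_def, Complex.conj_ofReal, ← Complex.ofReal_mul,
          Complex.ofReal_re]
        exact Real.mul_self_sqrt (schmidtWeight_pos hp n x).le
    rw [h1, trace_maxCorrelated, h2]
    have h3 := sum_schmidtWeight hp n
    have h4 : ∑ x, schmidtWeight p n x =
        (∑ x, if x = 0 then 0 else schmidtWeight p n x) + schmidtWeight p n 0 := by
      rw [← Finset.sum_erase_add _ _ (Finset.mem_univ (0 : Fin n → Fin 2)),
        ← Finset.sum_erase_add (f := fun x => if x = 0 then 0 else schmidtWeight p n x) _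
          (Finset.mem_univ (0 : Fin n → Fin 2)), if_pos rfl, add_zero]
      congr 1
      refine Finset.sum_congr rfl fun x hx => ?_
      rw [if_neg (Finset.ne_of_mem_erase hx)]
    have h5 : schmidtWeight p n 0 = ∏ i ∈ Finset.range n, (1 - p i) := by
      simp only [schmidtWeight, Pi.zero_apply, if_true]
      exact Fin.prod_univ_eq_prod_range (fun i => 1 - p i) n
    have h6 := one_sub_sum_le_prod hp n
    linarith

/-! ### Lower bound on the entanglement entropy. -/

theorem sum_prod_mul {n : ℕ} (F : Fin n → Fin 2 → ℝ) (hF : ∀ i, ∑ a, F i a = 1) (i : Fin n)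
    (g : Fin 2 → ℝ) :
    ∑ x : Fin n → Fin 2, (∏ j, F j (x j)) * g (x i) = ∑ a, F i a * g a := by
  have h : ∀ x : Fin n → Fin 2, (∏ j, F j (x j)) * g (x i) =
      ∏ j, F j (x j) * (if j = i then g (x j) else 1) := by
    intro x
    rw [Finset.prod_mul_distrib]
    simp
  simp only [h]
  rw [← Fintype.prod_sum (fun j a => F j a * (if j = i then g a else 1)),
    Finset.prod_eq_single i]
  · simp
  · intro j _ hj
    simpa [hj] using hF j
  · simp

/-- The logarithm of the product weight splits into coordinates, and by `sum_prod_mul` each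
expectation is a binary entropy, of which the nonnegative `1 - p i` term is discarded. -/
theorem entanglementEntropy_ge {p : ℕ → ℝ} (hp : ∀ i, 0 < p i ∧ p i < 1) (n : ℕ) :
    (∑ i ∈ Finset.range n, p i * -Real.log (p i)) / Real.log 2 ≤
      entanglementEntropy (productState (fun i => twoQubitState (p i)) n) := by
  have hlog2 : 0 < Real.log 2 := Real.log_pos (by norm_num)
  have hdiag : traceOutBob (pureState (productState (fun i => twoQubitState (p i)) n)) =
      Matrix.diagonal fun x => ((schmidtWeight p n x : ℝ) : ℂ) := by
    rw [productState_twoQubitState hp]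
    ext a a'
    simp only [traceOutBob, pureState, Matrix.of_apply, Matrix.vecMulVec_apply, Pi.star_apply,
      Matrix.diagonal_apply]
    rw [Finset.sum_eq_single a]
    · by_cases h : a = a'
      · subst h
        simp only [if_true, Complex.star_def, Complex.conj_ofReal, ← Complex.ofReal_mul,
          Real.mul_self_sqrt (schmidtWeight_pos hp n a).le]
      · simp [h, Ne.symm h]
    · intro b _ hb
      simp [Ne.symm hb]
    · simp
  have hent : entanglementEntropy (productState (fun i => twoQubitState (p i)) n) =
      ∑ x, -(schmidtWeight p n x * Real.logb 2 (schmidtWeight p n x)) := by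
    rw [entanglementEntropy, vonNeumannEntropy]
    refine sum_eigenvalues_of_charpoly _ (schmidtWeight p n) ?_
      (fun y => -(y * Real.logb 2 y))
    rw [hdiag, Matrix.charpoly_diagonal]
  have hpos : ∀ (x : Fin n → Fin 2) i, (if x i = 0 then 1 - p i else p i) ≠ 0 := by
    intro x i
    split_ifs
    · linarith [(hp i).2]
    · exact (hp i).1.ne'
  have hlog : ∀ x, -(schmidtWeight p n x * Real.logb 2 (schmidtWeight p n x)) =
      (∑ i : Fin n, schmidtWeight p n x *
        -Real.log (if x i = 0 then 1 - p i else p i)) / Real.log 2 := by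
    intro x
    rw [Real.logb, ← Finset.mul_sum, Finset.sum_neg_distrib,
      ← Real.log_prod fun i _ => hpos x i, ← schmidtWeight]
    ring
  rw [hent, Finset.sum_congr rfl fun x _ => hlog x, ← Finset.sum_div, Finset.sum_comm,
    ← Fin.sum_univ_eq_sum_range (fun i => p i * -Real.log (p i))]
  refine div_le_div_of_nonneg_right (Finset.sum_le_sum fun i _ => ?_) hlog2.le
  have := sum_prod_mul (fun (j : Fin n) a => if a = 0 then 1 - p j else p j)
    (fun j => by simp [Fin.sum_univ_two]) i (fun a => -Real.log (if a = 0 then 1 - p i else p i))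
  simp only [schmidtWeight]
  rw [this]
  simp only [Fin.sum_univ_two, if_true, one_ne_zero, if_false]
  have h1 : 0 ≤ (1 - p i) * -Real.log (1 - p i) :=
    mul_nonneg (by linarith [(hp i).2])
      (neg_nonneg.2 (Real.log_nonpos (by linarith [(hp i).2]) (by linarith [(hp i).1])))
  linarith

/-! ### Small probabilities with divergent entropy. -/

theorem log_natCast_nonneg_and_mono {m n : ℕ} (hm : 0 < m) (hmn : m ≤ n) :
    0 ≤ Real.log m ∧ Real.log m ≤ Real.log n :=
  ⟨Real.log_natCast_nonneg m, Real.log_le_log (by exact_mod_cast hm) (by exact_mod_cast hmn)⟩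

/-- Cauchy condensation turns the terms into `1 / (k log 2 + 1)²`. The `+ 1` avoids the zero of
`log` at `1`. -/
theorem summable_inv_mul_log_sq :
    Summable fun n : ℕ => ((n : ℝ) * (Real.log n + 1) ^ 2)⁻¹ := by
  rw [← summable_condensed_iff_of_nonneg]
  · have hlog2 : 0 < Real.log 2 := Real.log_pos (by norm_num)
    have hlog2' : Real.log 2 < 1 := by
      have := Real.log_two_lt_d9
      linarith
    have hs : Summable fun k : ℕ => (Real.log 2 ^ 2)⁻¹ * (((k + 1 : ℕ) : ℝ) ^ 2)⁻¹ :=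
      ((summable_nat_add_iff 1).2 (Real.summable_nat_pow_inv.2 one_lt_two)).mul_left _
    refine hs.of_nonneg_of_le (fun k => by positivity) fun k => ?_
    push_cast
    rw [Real.log_pow, mul_inv, ← mul_assoc, mul_inv_cancel₀ (by positivity), one_mul, ← mul_inv,
      ← mul_pow]
    refine inv_anti₀ (by positivity) (pow_le_pow_left₀ (by positivity) ?_ 2)
    linarith
  · intro n
    positivity
  · intro m n hm hmn
    obtain ⟨h0, h1⟩ := log_natCast_nonneg_and_mono hm hmn
    have hm' : (0 : ℝ) < m := by exact_mod_cast hm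
    have hmn' : (m : ℝ) ≤ n := by exact_mod_cast hmn
    gcongr

theorem not_summable_inv_mul_log :
    ¬ Summable fun n : ℕ => ((n : ℝ) * (Real.log n + 1))⁻¹ := by
  rw [← summable_condensed_iff_of_nonneg]
  · intro h
    have hlog2 : 0 < Real.log 2 := Real.log_pos (by norm_num)
    have hlog2' : Real.log 2 < 1 := by
      have := Real.log_two_lt_d9
      linarith
    refine Real.not_summable_natCast_inv ((summable_nat_add_iff 1).1
      (h.of_nonneg_of_le (fun k => by positivity) fun k => ?_))
    push_cast
    rw [Real.log_pow, mul_inv, ← mul_assoc, mul_inv_cancel₀ (by positivity), one_mul]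
    refine inv_anti₀ (by positivity) ?_
    have : (k : ℝ) * Real.log 2 ≤ k * 1 :=
      mul_le_mul_of_nonneg_left hlog2'.le (Nat.cast_nonneg k)
    linarith
  · intro n
    positivity
  · intro m n hm hmn
    obtain ⟨h0, h1⟩ := log_natCast_nonneg_and_mono hm hmn
    have hm' : (0 : ℝ) < m := by exact_mod_cast hm
    have hmn' : (m : ℝ) ≤ n := by exact_mod_cast hmn
    gcongr

/-- Probabilities with small sum but infinite entropy. -/
theorem exists_small_sum_large_entropy {η : ℝ} (hη : 0 < η) :
    ∃ p : ℕ → ℝ, (∀ i, 0 < p i ∧ p i < 1) ∧ (∀ n, ∑ i ∈ Finset.range n, p i ≤ η) ∧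
      Filter.Tendsto (fun n => ∑ i ∈ Finset.range n, p i * -Real.log (p i))
        Filter.atTop Filter.atTop := by
  -- The shift by `3 > e` makes the logarithm at least `1`.
  set g : ℕ → ℝ := fun i => (((i + 3 : ℕ) : ℝ) * (Real.log (i + 3 : ℕ) + 1) ^ 2)⁻¹ with hg
  have hgs : Summable g := (summable_nat_add_iff 3).2 summable_inv_mul_log_sq
  have hl1 : ∀ i : ℕ, 1 ≤ Real.log (i + 3 : ℕ) := by
    intro i
    rw [Real.le_log_iff_exp_le (by positivity)]
    have := Real.exp_one_lt_d9
    push_cast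
    have : (0 : ℝ) ≤ i := Nat.cast_nonneg i
    linarith
  have hg0 : ∀ i, 0 < g i := fun i => by
    have := hl1 i
    positivity
  have hg1 : ∀ i, g i ≤ ((i + 3 : ℕ) : ℝ)⁻¹ := by
    intro i
    refine inv_anti₀ (by positivity) (le_mul_of_one_le_right (by positivity) ?_)
    have := hl1 i
    nlinarith
  have hG0 : 0 ≤ ∑' i, g i := tsum_nonneg fun i => (hg0 i).le
  -- The bound by `1` keeps `c * g i ≤ 1 / (i + 3)`, the other bound makes the total at most `η`.
  set c := min 1 (η / (1 + ∑' i, g i)) with hc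
  have hc0 : 0 < c := lt_min one_pos (by positivity)
  have hc1 : c ≤ 1 := min_le_left _ _
  have hcη : c * (1 + ∑' i, g i) ≤ η := by
    rw [← le_div_iff₀ (by positivity)]
    exact min_le_right _ _
  have hcg : ∀ i, c * g i ≤ ((i + 3 : ℕ) : ℝ)⁻¹ := fun i =>
    (mul_le_of_le_one_left (hg0 i).le hc1).trans (hg1 i)
  refine ⟨fun i => c * g i, fun i => ⟨mul_pos hc0 (hg0 i), (hcg i).trans_lt ?_⟩, fun n => ?_, ?_⟩
  · refine inv_lt_one_of_one_lt₀ ?_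
    push_cast
    have : (0 : ℝ) ≤ i := Nat.cast_nonneg i
    linarith
  · rw [← Finset.mul_sum]
    have := hgs.sum_le_tsum (Finset.range n) fun i _ => (hg0 i).le
    have h2 := mul_le_mul_of_nonneg_left this hc0.le
    linarith
  · have hns : ¬ Summable fun i : ℕ =>
        (c / 2) * (((i + 3 : ℕ) : ℝ) * (Real.log (i + 3 : ℕ) + 1))⁻¹ := by
      rw [summable_mul_left_iff (by positivity)]
      exact fun h => not_summable_inv_mul_log ((summable_nat_add_iff 3).1 h)
    rw [not_summable_iff_tendsto_nat_atTop_of_nonneg] at hns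
    · refine Filter.tendsto_atTop_mono (fun n => Finset.sum_le_sum fun i _ => ?_) hns
      have h1 := hl1 i
      have h2 : Real.log (i + 3 : ℕ) ≤ -Real.log (c * g i) := by
        rw [← Real.log_inv]
        refine Real.log_le_log (by positivity) ?_
        rw [le_inv_comm₀ (by positivity) (mul_pos hc0 (hg0 i))]
        exact hcg i
      refine le_trans ?_ (mul_le_mul_of_nonneg_left h2 (mul_pos hc0 (hg0 i)).le)
      simp only [hg]
      set l := Real.log (i + 3 : ℕ)
      set N := ((i + 3 : ℕ) : ℝ)
      have hN : 0 < N := by positivity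
      -- Since `l ≥ 1`, `l / (l + 1) ≥ 1/2`: the logarithm cancels one factor `l + 1` up to `1/2`,
      -- leaving the divergent series.
      have : c * (N * (l + 1) ^ 2)⁻¹ * l - c / 2 * (N * (l + 1))⁻¹ =
          c * (l - 1) / (2 * N * (l + 1) ^ 2) := by
        have : l + 1 ≠ 0 := by positivity
        field_simp
        ring
      have h3 : 0 ≤ c * (l - 1) / (2 * N * (l + 1) ^ 2) :=
        div_nonneg (mul_nonneg hc0.le (by linarith)) (by positivity)
      linarith
    · intro i
      have := hl1 i
      positivity

end Catalysis

theorem mainTheorem4 (f : ℝ) (hf : 1 / 2 < f) (ε : ℝ) (hε : 0 < ε) :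
    ∃ p : ℕ → ℝ, (∀ i, 0 < p i ∧ p i < 1) ∧
      (∀ n : ℕ, ∃ q < ε, ∀ s ∈ Catalysis.singletProbabilities
        (Catalysis.pureState
          (Catalysis.productState (fun i => Catalysis.twoQubitState (p i)) n)) f, s ≤ q) ∧
      Filter.Tendsto
        (fun n : ℕ => Catalysis.entanglementEntropy
          (Catalysis.productState (fun i => Catalysis.twoQubitState (p i)) n))
        Filter.atTop Filter.atTop ∧
      (∀ m : ℕ, ∀ᶠ n : ℕ in Filter.atTop, Catalysis.CatalyticallyConvertible
        (Catalysis.pureState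
          (Catalysis.productState (fun i => Catalysis.twoQubitState (p i)) n))
        (Catalysis.pureState (Catalysis.productState (fun _ => Catalysis.singlet) m))) := by
  obtain ⟨K, hK, hbound⟩ := Catalysis.exists_trace_le hf
  -- As `K` depends only on `f`, this `η` bounds every success probability by `K * η = ε / 2`, for
  -- all `n` at once.
  obtain ⟨p, hp, hsum, hent⟩ :=
    Catalysis.exists_small_sum_large_entropy (η := ε / (2 * K)) (by positivity)
  refine ⟨p, hp, fun n => ⟨ε / 2, by linarith, ?_⟩, ?_, fun m => ?_⟩
  · rintro s ⟨Λ, hΛ, htr, hs, hfs⟩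
    obtain ⟨x, y, w, hψ, hw⟩ := Catalysis.exists_productState_eq_add hp n
    rw [hψ] at htr hfs
    have hre := congrArg Complex.re htr
    rw [Complex.ofReal_re] at hre
    have h := hbound (Catalysis.isEntanglementMonotone_of_protocolMap hΛ) x y w
    rw [hre] at h
    have h1 := h ((le_div_iff₀ hs).1 hfs)
    have h2 : K * (Catalysis.pureState w).trace.re ≤ K * (ε / (2 * K)) :=
      mul_le_mul_of_nonneg_left (hw.trans (hsum n)) hK.le
    have h3 : K * (ε / (2 * K)) = ε / 2 := by field_simp
    linarith
  · exact Filter.tendsto_atTop_mono (fun n => Catalysis.entanglementEntropy_ge hp n)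
      (hent.atTop_div_const (Real.log_pos (by norm_num)))
  · filter_upwards [hent.eventually_gt_atTop (2 * (m * Real.log 2)),
      Filter.eventually_ge_atTop m] with n hn hmn
    exact Catalysis.catalyticallyConvertible_of_lt hp hmn hn
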